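/- A finite PO-DTMC $M=(S,PI,PT,O_1,\dots,O_n,\pi)$ for $n$ agents consists of a finite set $S$ of states, an initial distribution $PI$ on $S$, a stochastic matrix $PT$ on $S$, an observation function $O_i$ on $S$ for each agent $i$, and a valuation $\pi(s)\subseteq \mathit{Prop}$ of a finite set $\mathit{Prop}$ of $k$ atomic propositions at each state $s$. As an input of an algorithm it is given by an explicit list of its data, with rational probabilities. An infinite path is a sequence $s_0s_1\dots$ of states with $PI(s_0)>0$ and $PT(s_j,s_{j+1})>0$ for all $j$; $\mu$ is the probability measure on infinite paths for which the paths with prefix $s_0\dots s_m$ have measure $PI(s_0)PT(s_0,s_1)\cdots PT(s_{m-1},s_m)$. Under the synchronous perfect recall semantics, the local state of agent $i$ at time $m$ on a path $\rho$ is the sequence $O_i(\rho(0))\dots O_i(\rho(m))$, and the value of $\mathrm{Pr}_i(p)$ at $(\rho,m)$ is the conditional probability under $\mu$ of the paths $\rho'$ with $p\in\pi(\rho'(m))$, given that agent $i$ has the same local state at $(\rho',m)$ as at $(\rho,m)$. We write $M\models^{\mathtt{spr}} EF(\mathrm{Pr}_i(p)>c)$ if for every infinite path $\rho$ there are an infinite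 path $\rho'$ with $\rho'(0)=\rho(0)$ and a time $m\ge 0$ such that the value of $\mathrm{Pr}_i(p)$ at $(\rho',m)$ is greater than $c$. Theorem. For all $n,k\ge 1$, every agent $i\in\{1,\dots,n\}$, every atomic proposition $p$ among the $k$, and every rational constant $c$ with $0<c<1$, the following problem is undecidable: given a finite PO-DTMC $M$ with $n$ agents and $k$ atomic propositions, determine whether $M\models^{\mathtt{spr}} EF(\mathrm{Pr}_i(p)>c)$. -/

import Mathlib

namespace PerfectRecall

/-! ### Systems of runs with a common prior -/

/-- A run maps each time to a global state: an environment state (in `E`) together with a local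
state (in `L`) for each agent. -/
abbrev Run (Agt E L : Type) : Type := ℕ → E × (Agt → L)

/-- The data `(R, Pr, π)`: a set `R` of runs, a prior `Pr = (R, F, μ)` on it, and an interpretation
`π` of the atomic propositions at the points `(r, m)` of `R × ℕ`. -/
structure PriorSystem (Agt E L AP : Type) where
  runs : Set (Run Agt E L)
  events : MeasurableSpace runs
  prior : @MeasureTheory.Measure runs events
  val : runs × ℕ → Set AP

namespace PriorSystem

variable {Agt E L AP : Type}

/-- The points `(r, m)` of the system. -/
abbrev Point (I : PriorSystem Agt E L AP) : Type := I.runs × ℕ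

/-- The local state `r_i(m)` of agent `i` at the point `x = (r, m)`. -/
def localState (I : PriorSystem Agt E L AP) (i : Agt) (x : I.Point) : L :=
  (x.1.1 x.2).2 i

/-- `K_i(r, m)`: the points that agent `i` cannot distinguish from `(r, m)`. -/
def indist (I : PriorSystem Agt E L AP) (i : Agt) (x : I.Point) : Set I.Point :=
  {y | I.localState i y = I.localState i x}

/-- `R(U)`: the runs passing through some point of `U`. -/
def runsThrough (I : PriorSystem Agt E L AP) (U : Set I.Point) : Set I.runs :=
  {r | ∃ m, (r, m) ∈ U}

/-- `μ_{r,m,i}(U) = μ(R(U) | R(K_i(r, m)))`, for sets `U ⊆ K_i(r, m)` of points. -/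
noncomputable def agentProb (I : PriorSystem Agt E L AP) (i : Agt) (x : I.Point)
    (U : Set I.Point) : ℝ :=
  (I.prior (I.runsThrough U ∩ I.runsThrough (I.indist i x))).toReal
    / (I.prior (I.runsThrough (I.indist i x))).toReal

end PriorSystem

/-! ### The temporal, epistemic and probabilistic logic -/

/-- The comparison symbols of the logic. -/
inductive Cmp : Type
  | le | lt | eq | gt | ge

/-- The relation on the reals denoted by a comparison symbol. -/
def Cmp.Holds : Cmp → ℝ → ℝ → Prop
  | .le, x, y => x ≤ y
  | .lt, x, y => x < y
  | .eq, x, y => x = y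
  | .gt, x, y => x > y
  | .ge, x, y => x ≥ y

mutual
/-- Formulas
`φ ::= p | ¬φ | φ ∧ φ | A φ | X φ | φ U φ | K_i φ | f(P_1, …, P_k) ⋈ c`,
where `f` is a polynomial with rational coefficients and `c` is rational. -/
inductive Formula (Agt AP : Type) : Type
  | atom (p : AP) : Formula Agt AP
  | neg (φ : Formula Agt AP) : Formula Agt AP
  | conj (φ ψ : Formula Agt AP) : Formula Agt AP
  | all (φ : Formula Agt AP) : Formula Agt AP
  | next (φ : Formula Agt AP) : Formula Agt AP
  | untl (φ ψ : Formula Agt AP) : Formula Agt AP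
  | know (i : Agt) (φ : Formula Agt AP) : Formula Agt AP
  | cmp (k : ℕ) (f : MvPolynomial (Fin k) ℚ) (P : Fin k → ProbTerm Agt AP)
      (rel : Cmp) (c : ℚ) : Formula Agt AP

/-- Basic probability expressions `P ::= Pr_i(φ) | Prior_i(φ)`. -/
inductive ProbTerm (Agt AP : Type) : Type
  | pr (i : Agt) (φ : Formula Agt AP) : ProbTerm Agt AP
  | prior (i : Agt) (φ : Formula Agt AP) : ProbTerm Agt AP
end

namespace Formula

variable {Agt AP : Type}

/-- The constant `true`, expressed as the tautology `¬(φ ∧ ¬φ)`. -/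
def top (φ : Formula Agt AP) : Formula Agt AP := neg (conj φ (neg φ))

/-- `F φ = true U φ`. -/
def eventually (φ : Formula Agt AP) : Formula Agt AP := untl (top φ) φ

/-- `E φ = ¬A¬φ`. -/
def ex (φ : Formula Agt AP) : Formula Agt AP := neg (all (neg φ))

/-- `Pr_i(φ) > c`. -/
noncomputable def probGt (i : Agt) (φ : Formula Agt AP) (c : ℚ) : Formula Agt AP :=
  cmp 1 (MvPolynomial.X 0) (fun _ => ProbTerm.pr i φ) Cmp.gt c

end Formula

section Semantics

variable {Agt E L AP : Type}

mutual
/-- `I, (r, m) ⊨ φ`. -/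
noncomputable def Sat (I : PriorSystem Agt E L AP) : Formula Agt AP → I.Point → Prop
  | .atom p, x => p ∈ I.val x
  | .neg φ, x => ¬ Sat I φ x
  | .conj φ ψ, x => Sat I φ x ∧ Sat I ψ x
  | .all φ, x => ∀ r' : I.runs, (∀ l ≤ x.2, r'.1 l = x.1.1 l) → Sat I φ (r', x.2)
  | .next φ, x => Sat I φ (x.1, x.2 + 1)
  | .untl φ ψ, x =>
      ∃ k, x.2 ≤ k ∧ Sat I ψ (x.1, k) ∧ ∀ l, x.2 ≤ l → l < k → Sat I φ (x.1, l)
  | .know i φ, x => ∀ y ∈ I.indist i x, Sat I φ y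
  | .cmp _ f P rel c, x => rel.Holds (MvPolynomial.aeval (fun j => termVal I (P j) x) f) c

/-- The value of a basic probability expression at a point. -/
noncomputable def termVal (I : PriorSystem Agt E L AP) : ProbTerm Agt AP → I.Point → ℝ
  | .pr i φ, x => I.agentProb i x {y | y ∈ I.indist i x ∧ Sat I φ y}
  | .prior i φ, x => I.agentProb i (x.1, 0) {y | y ∈ I.indist i (x.1, 0) ∧ Sat I φ y}
end

end Semantics

/-! ### Partially observed Markov chains -/

/-- An interpreted partially observed discrete-time Markov chain with finite state set `S`. -/
structure PODTMC (Agt S Obs AP : Type) [Fintype S] where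
  init : S → ℝ
  trans : S → S → ℝ
  init_nonneg : ∀ s, 0 ≤ init s
  init_sum : ∑ s, init s = 1
  trans_nonneg : ∀ s t, 0 ≤ trans s t
  trans_sum : ∀ s, ∑ t, trans s t = 1
  obs : Agt → S → Obs
  val : S → Set AP

namespace PODTMC

variable {Agt S Obs AP : Type} [Fintype S]

/-- The infinite paths of `M`. -/
def IsPath (M : PODTMC Agt S Obs AP) (ρ : ℕ → S) : Prop :=
  M.init (ρ 0) ≠ 0 ∧ ∀ k, 0 < M.trans (ρ k) (ρ (k + 1))

/-- The type of infinite paths of `M`. -/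
abbrev Path (M : PODTMC Agt S Obs AP) : Type := {ρ : ℕ → S // M.IsPath ρ}

/-- The initial distribution. -/
noncomputable def initPMF (M : PODTMC Agt S Obs AP) : PMF S :=
  PMF.ofFintype (fun s => ENNReal.ofReal (M.init s)) (by
    rw [← ENNReal.ofReal_sum_of_nonneg (fun s _ => M.init_nonneg s), M.init_sum,
      ENNReal.ofReal_one])

/-- The distribution of the successor of the state `s`. -/
noncomputable def stepPMF (M : PODTMC Agt S Obs AP) (s : S) : PMF S :=
  PMF.ofFintype (fun t => ENNReal.ofReal (M.trans s t)) (by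
    rw [← ENNReal.ofReal_sum_of_nonneg (fun t _ => M.trans_nonneg s t), M.trans_sum,
      ENNReal.ofReal_one])

variable [MeasurableSpace S] [DiscreteMeasurableSpace S]

/-- The transition kernel of the chain. -/
noncomputable def stepKernel (M : PODTMC Agt S Obs AP) : ProbabilityTheory.Kernel S S :=
  ProbabilityTheory.Kernel.ofFunOfCountable (fun s => (M.stepPMF s).toMeasure)

instance (M : PODTMC Agt S Obs AP) : ProbabilityTheory.IsMarkovKernel M.stepKernel :=
  ⟨fun s => PMF.toMeasure.isProbabilityMeasure (M.stepPMF s)⟩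

/-- The next-state kernel given the history up to time `n`: it uses only the state at time `n`. -/
noncomputable def histKernel (M : PODTMC Agt S Obs AP) (n : ℕ) :
    ProbabilityTheory.Kernel (Finset.Iic n → S) S :=
  M.stepKernel.comap (fun h => h ⟨n, Finset.mem_Iic.2 le_rfl⟩) (measurable_pi_apply _)

instance (M : PODTMC Agt S Obs AP) (n : ℕ) :
    ProbabilityTheory.IsMarkovKernel (M.histKernel n) := by
  unfold histKernel; infer_instance

/-- The law of the chain on all sequences of states: the set of the sequences with prefix
`s_0 … s_m` has measure `PI(s_0) · PT(s_0, s_1) ⋯ PT(s_{m-1}, s_m)`. -/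
noncomputable def seqMeasure (M : PODTMC Agt S Obs AP) : MeasureTheory.Measure (ℕ → S) :=
  ProbabilityTheory.Kernel.trajMeasure (X := fun _ => S) M.initPMF.toMeasure M.histKernel

/-- The probability measure of `Pr(M)` on the infinite paths of `M`. (The sequences that are not
paths form a measurable set of measure zero.) -/
noncomputable def pathMeasure (M : PODTMC Agt S Obs AP) : MeasureTheory.Measure M.Path :=
  M.seqMeasure.comap Subtype.val

/-- The run `ρ^spr` of a path `ρ`: the local state of agent `i` at time `m` is the sequence
`O_i(ρ(0)) … O_i(ρ(m))` of all its observations so far. -/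
def sprRun (M : PODTMC Agt S Obs AP) (ρ : ℕ → S) : Run Agt S (List Obs) :=
  fun m => (ρ m, fun i => List.ofFn fun j : Fin (m + 1) => M.obs i (ρ j))

/-- The set `R^spr(M)` of the runs `ρ^spr`, for `ρ` an infinite path of `M`. -/
def sprRuns (M : PODTMC Agt S Obs AP) : Set (Run Agt S (List Obs)) :=
  Set.range fun ρ : M.Path => M.sprRun ρ.1

/-- The bijection `ρ ↦ ρ^spr` from paths to runs. -/
def toSprRuns (M : PODTMC Agt S Obs AP) (ρ : M.Path) : M.sprRuns :=
  ⟨M.sprRun ρ.1, Set.mem_range_self ρ⟩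

/-- The system `I^spr(M)`. Events and prior are transported from paths to runs along `ρ ↦ ρ^spr`. -/
noncomputable def sprSystem (M : PODTMC Agt S Obs AP) : PriorSystem Agt S (List Obs) AP where
  runs := M.sprRuns
  events := MeasurableSpace.map M.toSprRuns inferInstance
  prior := @MeasureTheory.Measure.map _ _ _ (MeasurableSpace.map M.toSprRuns inferInstance)
    M.toSprRuns M.pathMeasure
  val := fun x => M.val (x.1.1 x.2).1

/-- `M ⊨^spr φ`: the formula `φ` holds at time `0` of all runs of `I^spr(M)`. -/
def SprModels (M : PODTMC Agt S Obs AP) (φ : Formula Agt AP) : Prop :=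
  ∀ r : M.sprSystem.runs, Sat M.sprSystem φ (r, 0)

end PODTMC

/-! ### Finite presentations as inputs of algorithms -/

/-- A finite PO-DTMC with `n` agents and `k` atomic propositions given by finite data: the states
are numbered `0, …, size - 1`, the probabilities are rational, and observations are named by
natural numbers. -/
structure FinitePODTMC (n k : ℕ) where
  size : ℕ
  init : Fin size → ℚ
  trans : Fin size → Fin size → ℚ
  init_nonneg : ∀ s, 0 ≤ init s
  init_sum : ∑ s, init s = 1
  trans_nonneg : ∀ s t, 0 ≤ trans s t
  trans_sum : ∀ s, ∑ t, trans s t = 1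
  obs : Fin n → Fin size → ℕ
  val : Fin size → Fin k → Bool

namespace FinitePODTMC

variable {n k : ℕ}

/-- The PO-DTMC given by the finite data. -/
def toPODTMC (M : FinitePODTMC n k) : PODTMC (Fin n) (Fin M.size) ℕ (Fin k) where
  init s := (M.init s : ℝ)
  trans s t := (M.trans s t : ℝ)
  init_nonneg s := by exact_mod_cast M.init_nonneg s
  init_sum := by exact_mod_cast M.init_sum
  trans_nonneg s t := by exact_mod_cast M.trans_nonneg s t
  trans_sum s := by exact_mod_cast M.trans_sum s
  obs := M.obs
  val s := {p | M.val s p = true}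

/-- Codes of finite PO-DTMCs: number of states, initial probabilities, matrix of transition
probabilities, observations of each agent, valuation. -/
abbrev Code : Type :=
  ℕ × List (ℕ × ℕ) × List (List (ℕ × ℕ)) × List (List ℕ) × List (List Bool)

/-- A nonnegative rational as the pair of its numerator and denominator in lowest terms. -/
def ratCode (q : ℚ) : ℕ × ℕ := (q.num.toNat, q.den)

/-- The code of a finite PO-DTMC: all its data, listed explicitly. -/
def encode (M : FinitePODTMC n k) : Code :=
  (M.size,
    List.ofFn fun s => ratCode (M.init s),
    List.ofFn fun s => List.ofFn fun t => ratCode (M.trans s t),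
    List.ofFn fun i => List.ofFn fun s => M.obs i s,
    List.ofFn fun s => List.ofFn fun p => M.val s p)

theorem ratCode_inj {q r : ℚ} (hq : 0 ≤ q) (hr : 0 ≤ r) (h : ratCode q = ratCode r) : q = r := by
  obtain ⟨h1, h2⟩ := Prod.ext_iff.1 h
  have hq' := Rat.num_nonneg.2 hq
  have hr' := Rat.num_nonneg.2 hr
  refine Rat.ext ?_ h2
  simp only [ratCode] at h1
  omega

/-- Distinct presentations have distinct codes. -/
theorem encode_injective : Function.Injective (encode : FinitePODTMC n k → Code) := by
  rintro ⟨m, PI, PT, hPI, hPI1, hPT, hPT1, O, V⟩ ⟨m', PI', PT', hPI', hPI1', hPT', hPT1', O', V'⟩ h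
  simp only [encode, Prod.mk.injEq] at h
  obtain ⟨rfl, h1, h2, h3, h4⟩ := h
  have e1 : PI = PI' := funext fun s =>
    ratCode_inj (hPI s) (hPI' s) (congrFun (List.ofFn_injective h1) s)
  have e2 : PT = PT' := funext fun s => funext fun t =>
    ratCode_inj (hPT s t) (hPT' s t)
      (congrFun (List.ofFn_injective (congrFun (List.ofFn_injective h2) s)) t)
  have e3 : O = O' := funext fun i => List.ofFn_injective (congrFun (List.ofFn_injective h3) i)
  have e4 : V = V' := funext fun s => List.ofFn_injective (congrFun (List.ofFn_injective h4) s)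
  subst e1 e2 e3 e4
  rfl

end FinitePODTMC

/-- A property of finite PO-DTMCs is decidable if some computable predicate on codes agrees with it
on the codes of all finite PO-DTMCs. -/
def DecidableProperty {n k : ℕ} (Q : FinitePODTMC n k → Prop) : Prop :=
  ∃ D : FinitePODTMC.Code → Prop, ComputablePred D ∧ ∀ M, D M.encode ↔ Q M

end PerfectRecall

/-!
Whether a partial recursive function halts is reduced to the problem in three steps.

A program on natural-valued registers whose only instructions are increments, clearings and
equality tests, with nondeterministic choice and iteration, is a regular language of instruction
words; it can guess a register by clearing and then incrementing it, so such programs compute the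
graphs of all partial recursive functions. Hence halting means that some word of a regular language
passes all its tests.

Without its tests, a word acts affinely on the registers, so the products of two registers evolve
linearly. A test `x = y` adds `(x - y) ^ 2` to an accumulator, and since the matrices must have
entries in `ℕ`, the summands `x ^ 2 + y ^ 2` and `2 * x * y` go to two different accumulators: a
word passes its tests if and only if the first accumulator does not exceed the second. The product
with a deterministic automaton enforces the regularity of the word, and halting becomes the
question whether some product of matrices over `ℕ`, applied to a row vector, gives more weight to
one column vector than to another.

In the chain the observations reveal the sequence of matrices applied but not the coordinate, so
the agent's forecast of the coordinate is proportional to the row vector times the product. Leaving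
the coordinates with weights `c * a` for the goal and `(1 - c) * b` for its alternative makes the
conditional probability of the goal exceed `c` precisely when `a` outweighs `b`. Only the initial
row vector depends on the input.
-/

namespace PerfectRecall

section RegularLanguages

variable {α : Type*}

theorem leftQuotient_sSup (T : Set (Language α)) (w : List α) :
    (sSup T).leftQuotient w = sSup ((fun K => K.leftQuotient w) '' T) := by
  ext z
  rw [Language.mem_leftQuotient, sSup_eq_iSup', sSup_image', Language.mem_iSup, Language.mem_iSup]
  rfl

theorem sSup_mul (T : Set (Language α)) (M : Language α) :
    sSup T * M = sSup ((fun K => K * M) '' T) := by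
  rw [sSup_eq_iSup', Language.iSup_mul, sSup_image']

/-- A set of languages closed, up to unions, under derivatives by letters. A finite such set plays
the role of the partial derivatives of Antimirov. -/
def DerivClosed (𝒟 : Set (Language α)) : Prop :=
  ∀ K ∈ 𝒟, ∀ a, ∃ T ⊆ 𝒟, K.leftQuotient [a] = sSup T

theorem DerivClosed.exists_leftQuotient_eq {𝒟 : Set (Language α)} (h : DerivClosed 𝒟)
    {K : Language α} (hK : K ∈ 𝒟) (w : List α) : ∃ T ⊆ 𝒟, K.leftQuotient w = sSup T := by
  induction w using List.reverseRecOn with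
  | nil => exact ⟨{K}, by simpa using hK, by simp⟩
  | append_singleton w a ih =>
    obtain ⟨T, hT, hw⟩ := ih
    choose! U hU ha using fun K hK => h K hK a
    refine ⟨⋃ K ∈ T, U K, Set.iUnion₂_subset fun K hK => hU K (hT hK), ?_⟩
    rw [Language.leftQuotient_append, hw, leftQuotient_sSup, sSup_iUnion, sSup_image]
    refine iSup_congr fun K => ?_
    rw [sSup_iUnion]
    exact iSup_congr fun hK => ha K (hT hK)

theorem DerivClosed.isRegular {𝒟 : Set (Language α)} (h : DerivClosed 𝒟) (hfin : 𝒟.Finite)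
    {K : Language α} (hK : K ∈ 𝒟) : K.IsRegular := by
  refine .of_finite_range_leftQuotient ((hfin.finite_subsets.image sSup).subset ?_)
  rintro _ ⟨w, rfl⟩
  obtain ⟨T, hT, hw⟩ := h.exists_leftQuotient_eq hK w
  exact ⟨T, hT, hw.symm⟩

theorem derivClosed_range_leftQuotient (L : Language α) :
    DerivClosed (Set.range L.leftQuotient) := by
  rintro _ ⟨w, rfl⟩ a
  exact ⟨{L.leftQuotient (w ++ [a])}, by simp, by simp [Language.leftQuotient_append]⟩

theorem cons_mem_mul_iff {L M : Language α} {a : α} {z : List α} :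
    a :: z ∈ L * M ↔ z ∈ L.leftQuotient [a] * M ∨ [] ∈ L ∧ z ∈ M.leftQuotient [a] := by
  simp only [Language.mem_mul, Language.mem_leftQuotient, List.singleton_append]
  constructor
  · rintro ⟨_ | ⟨b, x⟩, hx, y, hy, h⟩
    · exact .inr ⟨hx, by rwa [← h]⟩
    · obtain ⟨rfl, rfl⟩ := List.cons.inj h
      exact .inl ⟨x, hx, y, hy, rfl⟩
  · rintro (⟨x, hx, y, hy, rfl⟩ | ⟨hL, hM⟩)
    · exact ⟨a :: x, hx, y, hy, rfl⟩
    · exact ⟨[], hL, _, hM, rfl⟩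

open Computability

theorem cons_mem_kstar_iff {L : Language α} {a : α} {z : List α} :
    a :: z ∈ L∗ ↔ z ∈ L.leftQuotient [a] * L∗ := by
  constructor
  · rw [Language.mem_kstar_iff_exists_nonempty]
    rintro ⟨_ | ⟨_ | ⟨b, x⟩, S⟩, hS, h⟩
    · cases hS
    · exact absurd rfl (h [] (by simp)).2
    · obtain ⟨rfl, rfl⟩ := List.cons.inj hS
      exact Language.append_mem_mul (h _ (by simp)).1
        (Language.join_mem_kstar fun y hy => (h y (by simp [hy])).1)
  · intro h
    obtain ⟨x, hx, y, hy, rfl⟩ := Language.mem_mul.1 h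
    rw [← Language.one_add_self_mul_kstar_eq_kstar, Language.mem_add, ← List.cons_append]
    exact .inr (Language.append_mem_mul hx hy)

theorem leftQuotient_mul_eq_sSup {K M : Language α} {a : α} {T U : Set (Language α)}
    (hK : K.leftQuotient [a] = sSup T) (hM : M.leftQuotient [a] = sSup U) :
    (K * M).leftQuotient [a] = sSup ((fun N => N * M) '' T ∪ {N ∈ U | [] ∈ K}) := by
  rw [sSup_union, ← sSup_mul, ← hK]
  ext z
  refine cons_mem_mul_iff.trans (or_congr_right ?_)
  by_cases h : [] ∈ K
  · simp only [h, true_and, and_true, Set.ofPred_mem_eq, hM]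
    rfl
  · simp only [h, false_and, and_false, Set.ofPred_false, sSup_empty]
    exact (iff_of_false id (Language.notMem_zero z))

theorem isRegular_mul {L M : Language α} (hL : L.IsRegular) (hM : M.IsRegular) :
    (L * M).IsRegular := by
  suffices h : DerivClosed ((fun K => K * M) '' Set.range L.leftQuotient ∪
      Set.range M.leftQuotient) from
    h.isRegular
      ((hL.finite_range_leftQuotient.image _).union hM.finite_range_leftQuotient)
      (.inl ⟨L, ⟨[], rfl⟩, rfl⟩)
  rintro _ (⟨K, hK, rfl⟩ | hK) a
  · obtain ⟨T, hT, hKa⟩ := derivClosed_range_leftQuotient L K hK a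
    obtain ⟨U, hU, hMa⟩ := derivClosed_range_leftQuotient M M ⟨[], rfl⟩ a
    exact ⟨_, Set.union_subset_union (Set.image_mono hT) fun N hN => hU hN.1,
      leftQuotient_mul_eq_sSup hKa hMa⟩
  · obtain ⟨U, hU, hKa⟩ := derivClosed_range_leftQuotient M _ hK a
    exact ⟨U, hU.trans Set.subset_union_right, hKa⟩

theorem isRegular_kstar {L : Language α} (hL : L.IsRegular) : L∗.IsRegular := by
  set 𝒟 := (fun K => K * L∗) '' Set.range L.leftQuotient
  have hstar (a : α) : (L∗).leftQuotient [a] = sSup {L.leftQuotient [a] * L∗} := by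
    rw [sSup_singleton]
    ext z
    exact cons_mem_kstar_iff
  have hmem (a : α) : L.leftQuotient [a] * L∗ ∈ 𝒟 := ⟨_, ⟨[a], rfl⟩, rfl⟩
  suffices h : DerivClosed (insert L∗ 𝒟) from
    h.isRegular ((hL.finite_range_leftQuotient.image _).insert _) (.inl rfl)
  rintro _ (rfl | ⟨K, hK, rfl⟩) a
  · exact ⟨_, Set.singleton_subset_iff.2 (.inr (hmem a)), hstar a⟩
  · obtain ⟨T, hT, hKa⟩ := derivClosed_range_leftQuotient L K hK a
    refine ⟨_, Set.union_subset ((Set.image_mono hT).trans (Set.subset_insert _ _)) ?_,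
      leftQuotient_mul_eq_sSup hKa (hstar a)⟩
    rintro _ ⟨rfl, -⟩
    exact .inr (hmem a)

theorem isRegular_of_finite {L : Language α} (hL : {w | w ∈ L}.Finite) : L.IsRegular := by
  have hfin : {w | ∃ z, w ++ z ∈ L}.Finite := by
    refine (hL.biUnion fun w _ => w.inits.finite_toSet).subset ?_
    rintro w ⟨z, hz⟩
    exact Set.mem_biUnion hz ((List.mem_inits _ _).2 ⟨z, rfl⟩)
  refine .of_finite_range_leftQuotient (((hfin.image L.leftQuotient).insert 0).subset ?_)
  rintro _ ⟨w, rfl⟩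
  by_cases h : ∃ z, w ++ z ∈ L
  · exact .inr ⟨w, h, rfl⟩
  · left
    ext z
    exact iff_of_false (fun hz => h ⟨z, hz⟩) (Language.notMem_zero z)

theorem isRegular_matches' (P : RegularExpression α) : P.matches'.IsRegular := by
  induction P with
  | zero => exact isRegular_of_finite Set.finite_empty
  | epsilon => exact isRegular_of_finite (Set.finite_singleton [])
  | char a => exact isRegular_of_finite (Set.finite_singleton [a])
  | plus P Q hP hQ => exact hP.add hQ
  | comp P Q hP hQ => exact isRegular_mul hP hQ
  | star P hP => exact isRegular_kstar hP

end RegularLanguages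

section RegisterPrograms

variable {ι κ : Type}

/-- Instructions on natural-valued registers: increment, clear, and test of equality. -/
inductive Instr (ι : Type) : Type
  | inc (i : ι)
  | clr (i : ι)
  | eq (i j : ι)

namespace Instr

open scoped Classical in
/-- The effect of an instruction on the registers. -/
noncomputable def act : Instr ι → (ι → ℕ) → ι → ℕ
  | inc i, x => Function.update x i (x i + 1)
  | clr i, x => Function.update x i 0
  | eq _ _, x => x

/-- The condition under which an instruction can be executed. -/
def Ok : Instr ι → (ι → ℕ) → Prop
  | eq i j, x => x i = x j
  | _, _ => True

/-- The instruction on the registers `κ` obtained by renaming. -/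
def map (f : ι → κ) : Instr ι → Instr κ
  | inc i => inc (f i)
  | clr i => clr (f i)
  | eq i j => eq (f i) (f j)

theorem ok_map (f : ι → κ) (l : Instr ι) (x : κ → ℕ) : (l.map f).Ok x ↔ l.Ok (x ∘ f) := by
  cases l <;> rfl

theorem act_map_comp {f : ι → κ} (hf : f.Injective) (l : Instr ι) (x : κ → ℕ) :
    (l.map f).act x ∘ f = l.act (x ∘ f) := by
  classical
  cases l <;> simp only [map, act, Function.update_comp_eq_of_injective _ hf, Function.comp_apply]

theorem act_map_of_notMem_range {f : ι → κ} (l : Instr ι) (x : κ → ℕ) {i : κ}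
    (hi : i ∉ Set.range f) : (l.map f).act x i = x i := by
  classical
  have hne (j : ι) : i ≠ f j := fun h => hi ⟨j, h.symm⟩
  cases l <;> simp only [map, act, Function.update_of_ne (hne _)]

end Instr

/-- The registers after a sequence of instructions, all tests being taken to succeed. -/
noncomputable def run (w : List (Instr ι)) (x : ι → ℕ) : ι → ℕ :=
  w.foldl (fun x l => l.act x) x

/-- All the tests of a sequence of instructions succeed. -/
def Passes : List (Instr ι) → (ι → ℕ) → Prop
  | [], _ => True
  | l :: w, x => l.Ok x ∧ Passes w (l.act x)

theorem run_append (u v : List (Instr ι)) (x : ι → ℕ) : run (u ++ v) x = run v (run u x) :=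
  List.foldl_append

theorem passes_append {u v : List (Instr ι)} {x : ι → ℕ} :
    Passes (u ++ v) x ↔ Passes u x ∧ Passes v (run u x) := by
  induction u generalizing x with
  | nil => exact iff_of_eq (true_and _).symm
  | cons l u ih => exact (and_congr_right fun _ => ih).trans and_assoc.symm

theorem passes_map {f : ι → κ} (hf : f.Injective) {w : List (Instr ι)} {x : κ → ℕ} :
    Passes (w.map (Instr.map f)) x ↔ Passes w (x ∘ f) := by
  induction w generalizing x with
  | nil => rfl
  | cons l w ih =>
    exact and_congr (l.ok_map f x) (ih.trans (by rw [Instr.act_map_comp hf]))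

theorem run_map_comp {f : ι → κ} (hf : f.Injective) (w : List (Instr ι)) (x : κ → ℕ) :
    run (w.map (Instr.map f)) x ∘ f = run w (x ∘ f) := by
  induction w generalizing x with
  | nil => rfl
  | cons l w ih => exact (ih _).trans (by rw [Instr.act_map_comp hf]; rfl)

theorem run_map_of_notMem_range {f : ι → κ} (w : List (Instr ι)) (x : κ → ℕ) {i : κ}
    (hi : i ∉ Set.range f) : run (w.map (Instr.map f)) x i = x i := by
  induction w generalizing x with
  | nil => rfl
  | cons l w ih => exact (ih _).trans (l.act_map_of_notMem_range x hi)

/-- The input-output relation of a nondeterministic program, presented as a regular expression over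
the instructions. -/
def Rel (P : RegularExpression (Instr ι)) (x y : ι → ℕ) : Prop :=
  ∃ w ∈ P.matches', Passes w x ∧ run w x = y

theorem rel_char {l : Instr ι} {x y : ι → ℕ} :
    Rel (.char l) x y ↔ l.Ok x ∧ l.act x = y := by
  refine ⟨?_, fun h => ⟨[l], rfl, ⟨h.1, trivial⟩, h.2⟩⟩
  rintro ⟨_, rfl, ⟨h, -⟩, rfl⟩
  exact ⟨h, rfl⟩

theorem rel_mul {P Q : RegularExpression (Instr ι)} {x y : ι → ℕ} :
    Rel (P * Q) x y ↔ ∃ z, Rel P x z ∧ Rel Q z y := by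
  constructor
  · rintro ⟨_, ⟨u, hu, v, hv, rfl⟩, h, rfl⟩
    obtain ⟨hu', hv'⟩ := passes_append.1 h
    exact ⟨_, ⟨u, hu, hu', rfl⟩, v, hv, hv', (run_append u v x).symm⟩
  · rintro ⟨_, ⟨u, hu, hu', rfl⟩, v, hv, hv', rfl⟩
    exact ⟨u ++ v, Language.append_mem_mul hu hv, passes_append.2 ⟨hu', hv'⟩, run_append u v x⟩

theorem rel_star {P : RegularExpression (Instr ι)} {x y : ι → ℕ} :
    Rel P.star x y ↔ Relation.ReflTransGen (Rel P) x y := by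
  constructor
  · rintro ⟨w, hw, h, rfl⟩
    obtain ⟨S, rfl, hS⟩ := Language.mem_kstar.1 hw
    clear hw
    induction S generalizing x with
    | nil => exact .refl
    | cons u S ih =>
      obtain ⟨hu, hS'⟩ := passes_append.1 h
      rw [List.flatten_cons, run_append]
      exact .head ⟨u, hS u (by simp), hu, rfl⟩ (ih (fun v hv => hS v (by simp [hv])) hS')
  · intro h
    induction h with
    | refl => exact ⟨[], Language.nil_mem_kstar _, trivial, rfl⟩
    | tail _ hyz ih =>
      obtain ⟨u, hu, hu', rfl⟩ := ih
      obtain ⟨v, hv, hv', rfl⟩ := hyz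
      obtain ⟨S, rfl, hS⟩ := Language.mem_kstar.1 hu
      refine ⟨S.flatten ++ v, Language.mem_kstar.2 ⟨S ++ [v], by simp, ?_⟩,
        passes_append.2 ⟨hu', hv'⟩, run_append _ _ _⟩
      simpa [or_imp, forall_and] using ⟨hS, hv⟩

/-- A relation between stores is realizable if it is the input-output relation of a program. -/
def Realizable (T : (ι → ℕ) → (ι → ℕ) → Prop) : Prop :=
  ∃ P : RegularExpression (Instr ι), ∀ x y, Rel P x y ↔ T x y

namespace Realizable

variable {T U : (ι → ℕ) → (ι → ℕ) → Prop}

theorem congr (hT : Realizable T) (h : ∀ x y, T x y ↔ U x y) : Realizable U :=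
  hT.imp fun _ hP x y => (hP x y).trans (h x y)

theorem comp (hT : Realizable T) (hU : Realizable U) : Realizable (Relation.Comp T U) := by
  obtain ⟨⟨P, hP⟩, Q, hQ⟩ := hT, hU
  exact ⟨P * Q, fun x y => rel_mul.trans (exists_congr fun z => and_congr (hP x z) (hQ z y))⟩

theorem reflTransGen (hT : Realizable T) : Realizable (Relation.ReflTransGen T) := by
  obtain ⟨P, hP⟩ := hT
  obtain rfl : Rel P = T := funext₂ fun x y => propext (hP x y)
  exact ⟨P.star, fun _ _ => rel_star⟩

theorem map (hT : Realizable T) {f : ι → κ} (hf : f.Injective) :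
    Realizable fun x y : κ → ℕ => T (x ∘ f) (y ∘ f) ∧ ∀ i ∉ Set.range f, y i = x i := by
  obtain ⟨P, hP⟩ := hT
  refine ⟨P.map (Instr.map f), fun x y => ?_⟩
  beta_reduce
  rw [← hP (x ∘ f), Rel, RegularExpression.matches'_map]
  constructor
  · rintro ⟨_, ⟨w, hw, rfl⟩, h, rfl⟩
    exact ⟨⟨w, hw, (passes_map hf).1 h, (run_map_comp hf w x).symm⟩,
      fun i hi => run_map_of_notMem_range w x hi⟩
  · rintro ⟨⟨w, hw, h, hrun⟩, hy⟩
    refine ⟨_, ⟨w, hw, rfl⟩, (passes_map hf).2 h, funext fun i => ?_⟩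
    by_cases hi : i ∈ Set.range f
    · obtain ⟨j, rfl⟩ := hi
      exact congrFun ((run_map_comp hf w x).trans hrun) j
    · exact (run_map_of_notMem_range w x hi).trans (hy i hi).symm

end Realizable

theorem realizable_eq : Realizable (Eq : (ι → ℕ) → (ι → ℕ) → Prop) := by
  refine ⟨1, fun x y => ⟨?_, fun h => ⟨[], rfl, trivial, h⟩⟩⟩
  rintro ⟨_, rfl, -, rfl⟩
  rfl

theorem realizable_char (l : Instr ι) : Realizable fun x y => l.Ok x ∧ l.act x = y :=
  ⟨.char l, fun _ _ => rel_char⟩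

theorem realizable_guess (i : ι) : Realizable fun x y : ι → ℕ => ∀ j ≠ i, y j = x j := by
  classical
  refine ((realizable_char (.clr i)).comp (realizable_char (.inc i)).reflTransGen).congr
    fun x y => ⟨?_, fun h => ?_⟩
  · rintro ⟨_, ⟨-, rfl⟩, hy⟩ j hj
    induction hy with
    | refl => exact Function.update_of_ne hj _ _
    | tail _ h ih =>
      obtain ⟨-, rfl⟩ := h
      exact (Function.update_of_ne hj _ _).trans ih
  · refine ⟨Function.update x i 0, ⟨trivial, by simp [Instr.act]⟩, ?_⟩
    have hy : Function.update x i (y i) = y := by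
      rw [Function.update_eq_iff]
      exact ⟨rfl, fun j hj => (h j hj).symm⟩
    rw [← hy]
    generalize y i = m
    induction m with
    | zero => exact .refl
    | succ m ih => exact ih.tail ⟨trivial, by simp [Instr.act]⟩

theorem realizable_havoc [Finite ι] (s : Set ι) :
    Realizable fun x y : ι → ℕ => ∀ i ∉ s, y i = x i := by
  classical
  induction s, s.toFinite using Set.Finite.induction_on with
  | empty => exact realizable_eq.congr fun x y => by simp [funext_iff, eq_comm]
  | @insert i s _ _ ih =>
    refine ((realizable_guess i).comp ih).congr fun x y => ⟨?_, fun h => ?_⟩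
    · rintro ⟨z, hz, hy⟩ j hj
      rw [Set.mem_insert_iff, not_or] at hj
      exact (hy j hj.2).trans (hz j hj.1)
    · refine ⟨Function.update x i (y i), fun j hj => Function.update_of_ne hj _ _, fun j hj => ?_⟩
      by_cases hji : j = i
      · rw [hji, Function.update_self]
      · rw [Function.update_of_ne hji, h j (by simp [hji, hj])]

theorem realizable_agree [Finite κ] (f g : κ → ι) :
    Realizable fun x y : ι → ℕ => x = y ∧ x ∘ f = x ∘ g := by
  have key (s : Set κ) : Realizable fun x y : ι → ℕ => x = y ∧ ∀ i ∈ s, x (f i) = x (g i) := by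
    induction s, s.toFinite using Set.Finite.induction_on with
    | empty => exact realizable_eq.congr fun x y => by simp
    | @insert i s _ _ ih =>
      refine ((realizable_char (.eq (f i) (g i))).comp ih).congr fun x y => ⟨?_, ?_⟩
      · rintro ⟨_, ⟨h, rfl⟩, rfl, hs⟩
        exact ⟨rfl, Set.forall_mem_insert.2 ⟨h, hs⟩⟩
      · rintro ⟨rfl, h⟩
        exact ⟨x, ⟨h i (by simp), rfl⟩, rfl, fun j hj => h j (by simp [hj])⟩
  exact (key .univ).congr fun x y => by simp [funext_iff]

theorem realizable_assign [Finite ι] [Finite κ] (s : Set ι) (f g : κ → ι) :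
    Realizable fun x y : ι → ℕ => (∀ i ∉ s, y i = x i) ∧ y ∘ f = y ∘ g := by
  refine ((realizable_havoc s).comp (realizable_agree f g)).congr fun x y => ⟨?_, ?_⟩
  · rintro ⟨z, hz, rfl, h⟩
    exact ⟨hz, h⟩
  · rintro ⟨hy, h⟩
    exact ⟨y, hy, rfl, h⟩

end RegisterPrograms

section CheckableRelations

variable {ι κ σ : Type}

open Sum (inl inr)

/-- A condition on stores is checkable if some program with additional scratch registers can be
executed exactly from the stores that satisfy it, and changes scratch registers only. The scratch
registers may start and end with arbitrary contents. -/
def Checkable (R : (ι → ℕ) → Prop) : Prop :=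
  ∃ (κ : Type) (_ : Finite κ),
    Realizable fun x y : ι ⊕ κ → ℕ => y ∘ inl = x ∘ inl ∧ R (x ∘ inl)

namespace Checkable

variable {R R' : (ι → ℕ) → Prop}

theorem congr (hR : Checkable R) (h : ∀ v, R v ↔ R' v) : Checkable R' := by
  rwa [← funext fun v => propext (h v)]

theorem of_realizable [Finite ι] [Finite κ] {T : (ι ⊕ κ → ℕ) → (ι ⊕ κ → ℕ) → Prop}
    (hT : Realizable T) (hTinl : ∀ x y, T x y → y ∘ inl = x ∘ inl)
    (hTR : ∀ v, R v ↔ ∃ x y, x ∘ inl = v ∧ T x y) : Checkable R := by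
  have hscratch := realizable_havoc (Set.range (inr : κ → ι ⊕ κ))
  refine ⟨κ, ‹_›, (hscratch.comp (hT.comp hscratch)).congr fun x y => ?_⟩
  have hinl (x y : ι ⊕ κ → ℕ) : (∀ i ∉ Set.range inr, y i = x i) ↔ y ∘ inl = x ∘ inl := by
    simp [funext_iff]
  simp only [Relation.Comp, hinl, hTR]
  constructor
  · rintro ⟨x', hx, y', hT', hy⟩
    exact ⟨hy.trans ((hTinl _ _ hT').trans hx), x', y', hx, hT'⟩
  · rintro ⟨hy, x', y', hx, hT'⟩
    exact ⟨x', hx, y', hT', hy.trans (hx.symm.trans (hTinl _ _ hT').symm)⟩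

theorem and [Finite ι] (hR : Checkable R) (hR' : Checkable R') :
    Checkable fun v => R v ∧ R' v := by
  obtain ⟨κ, _, h⟩ := hR
  obtain ⟨κ', _, h'⟩ := hR'
  have hf : (Sum.map id inl : ι ⊕ κ → ι ⊕ (κ ⊕ κ')).Injective :=
    Sum.map_injective.2 ⟨Function.injective_id, Sum.inl_injective⟩
  have hf' : (Sum.map id inr : ι ⊕ κ' → ι ⊕ (κ ⊕ κ')).Injective :=
    Sum.map_injective.2 ⟨Function.injective_id, Sum.inr_injective⟩
  refine of_realizable ((h.map hf).comp (h'.map hf')) ?_ fun v => ⟨fun hv => ?_, ?_⟩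
  · rintro x y ⟨z, ⟨⟨hz, -⟩, -⟩, ⟨hy, -⟩, -⟩
    exact hy.trans hz
  · exact ⟨Sum.elim v 0, Sum.elim v 0, rfl, Sum.elim v 0, ⟨⟨rfl, hv.1⟩, fun _ _ => rfl⟩,
      ⟨rfl, hv.2⟩, fun _ _ => rfl⟩
  · rintro ⟨x, y, rfl, z, ⟨⟨hz, hx⟩, -⟩, ⟨-, hx'⟩, -⟩
    refine ⟨hx, ?_⟩
    change z ∘ inl = x ∘ inl at hz
    rw [← hz]
    exact hx'

theorem comp [Finite ι] [Finite σ] (hR : Checkable R) (f : ι → σ) :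
    Checkable fun v : σ → ℕ => R (v ∘ f) := by
  obtain ⟨κ, _, h⟩ := hR
  refine of_realizable ((realizable_agree (inl ∘ f) (inr ∘ inl)).comp (h.map Sum.inr_injective))
    ?_ fun v => ⟨fun hv => ?_, ?_⟩
  · rintro x y ⟨_, ⟨rfl, -⟩, -, hy⟩
    exact funext fun i => hy _ (by simp)
  · let x : σ ⊕ (ι ⊕ κ) → ℕ := Sum.elim v (Sum.elim (v ∘ f) 0)
    exact ⟨x, x, rfl, x, ⟨rfl, rfl⟩, ⟨rfl, hv⟩, fun _ _ => rfl⟩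
  · rintro ⟨x, y, rfl, _, ⟨rfl, hx⟩, ⟨-, hR⟩, -⟩
    change R (x ∘ inl ∘ f)
    rwa [hx]

theorem exists_elim [Finite ι] [Finite σ] {R : (ι ⊕ σ → ℕ) → Prop} (hR : Checkable R) :
    Checkable fun v => ∃ u : σ → ℕ, R (Sum.elim v u) := by
  obtain ⟨κ, _, h⟩ := hR
  refine of_realizable (h.map (Equiv.sumAssoc ι σ κ).injective) ?_ fun v => ⟨?_, ?_⟩
  · rintro x y ⟨⟨hy, -⟩, -⟩
    exact funext fun i => congrFun hy (inl i)
  · rintro ⟨u, hu⟩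
    let x : ι ⊕ (σ ⊕ κ) → ℕ := Sum.elim v (Sum.elim u 0)
    have hx : (x ∘ Equiv.sumAssoc ι σ κ) ∘ inl = Sum.elim v u := by
      ext (i | i) <;> rfl
    exact ⟨x, x, rfl, ⟨rfl, by rwa [hx]⟩, fun _ _ => rfl⟩
  · rintro ⟨x, y, rfl, ⟨-, hx⟩, -⟩
    refine ⟨x ∘ inr ∘ inl, ?_⟩
    convert hx using 1
    ext (i | i) <;> rfl

end Checkable

theorem checkable_true [Finite ι] : Checkable fun _ : ι → ℕ => True := by
  refine .of_realizable (κ := Empty) realizable_eq ?_ fun v => iff_of_true trivial ?_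
  · rintro x _ rfl
    rfl
  · exact ⟨Sum.elim v 0, _, rfl, rfl⟩

theorem checkable_eq [Finite ι] (i j : ι) : Checkable fun v : ι → ℕ => v i = v j := by
  refine .of_realizable (κ := Empty) (realizable_char (.eq (inl i) (inl j))) ?_ fun v => ⟨?_, ?_⟩
  · rintro x _ ⟨-, rfl⟩
    rfl
  · exact fun h => ⟨Sum.elim v 0, _, rfl, h, rfl⟩
  · rintro ⟨x, y, rfl, h, -⟩
    exact h

theorem checkable_eq_zero [Finite ι] (i : ι) : Checkable fun v : ι → ℕ => v i = 0 := by
  classical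
  refine .of_realizable (κ := Unit) ((realizable_char (.clr (inr ()))).comp
    (realizable_char (.eq (inl i) (inr ())))) ?_ fun v => ⟨fun h => ?_, ?_⟩
  · rintro x _ ⟨_, ⟨-, rfl⟩, -, rfl⟩
    ext k
    simp [Instr.act]
  · exact ⟨Sum.elim v 0, _, rfl, _, ⟨trivial, rfl⟩, by simpa [Instr.Ok, Instr.act] using h, rfl⟩
  · rintro ⟨x, y, rfl, _, ⟨-, rfl⟩, h, -⟩
    simpa [Instr.Ok, Instr.act] using h

theorem checkable_eq_succ [Finite ι] (i j : ι) :
    Checkable fun v : ι → ℕ => v i = v j + 1 := by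
  classical
  refine .of_realizable (κ := Unit) ((realizable_char (.eq (inl j) (inr ()))).comp
    ((realizable_char (.inc (inr ()))).comp
    (realizable_char (.eq (inl i) (inr ()))))) ?_ fun v => ⟨fun h => ?_, ?_⟩
  · rintro x _ ⟨_, ⟨-, rfl⟩, _, ⟨-, rfl⟩, -, rfl⟩
    ext k
    simp [Instr.act]
  · exact ⟨Sum.elim v fun _ => v j, _, rfl, _, ⟨rfl, rfl⟩, _, ⟨trivial, rfl⟩,
      by simpa [Instr.Ok, Instr.act] using h, rfl⟩
  · rintro ⟨x, y, rfl, _, ⟨h, rfl⟩, _, ⟨-, rfl⟩, h', -⟩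
    simp_all [Instr.Ok, Instr.act]

theorem Checkable.forall [Finite ι] [Finite σ] {R : σ → (ι → ℕ) → Prop} (h : ∀ s, Checkable (R s)) :
    Checkable fun v => ∀ s, R s v := by
  suffices key : ∀ t : Set σ, Checkable fun v => ∀ s ∈ t, R s v from
    (key .univ).congr fun v => by simp
  intro t
  induction t, t.toFinite using Set.Finite.induction_on with
  | empty => exact checkable_true.congr fun v => by simp
  | insert _ _ ih => exact ((h _).and ih).congr fun v => by rw [Set.forall_mem_insert]

theorem reflTransGen_of_forall_step {α β γ : Type*} {B : α → α → Prop}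
    {S : β → γ → γ → Prop} {par : α → β} {cur : α → γ}
    (hB : ∀ x y, B x y → par y = par x ∧ S (par x) (cur x) (cur y)) {x y : α}
    (h : Relation.ReflTransGen B x y) :
    par y = par x ∧ Relation.ReflTransGen (S (par x)) (cur x) (cur y) := by
  induction h with
  | refl => exact ⟨rfl, .refl⟩
  | tail _ hyz ih =>
    obtain ⟨hpar, hcur⟩ := hB _ _ hyz
    exact ⟨hpar.trans ih.1, ih.2.tail (ih.1 ▸ hcur)⟩

theorem exists_reflTransGen_of_exists_step {α β γ : Type*} {B : α → α → Prop}
    {S : β → γ → γ → Prop} {par : α → β} {cur : α → γ}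
    (hB : ∀ x q, S (par x) (cur x) q → ∃ y, B x y ∧ par y = par x ∧ cur y = q) {x : α} {q : γ}
    (h : Relation.ReflTransGen (S (par x)) (cur x) q) :
    ∃ y, Relation.ReflTransGen B x y ∧ par y = par x ∧ cur y = q := by
  induction h with
  | refl => exact ⟨x, .refl, rfl, rfl⟩
  | tail _ hqr ih =>
    obtain ⟨y, hxy, hpar, rfl⟩ := ih
    obtain ⟨z, hyz, hpar', hcur⟩ := hB y _ (hpar ▸ hqr)
    exact ⟨z, hxy.tail hyz, hpar'.trans hpar, hcur⟩

/-- The body of the loop computing a transitive closure: guess a next value, check that it is a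
successor of the current one, and make it current. -/
theorem Checkable.exists_realizable_step [Finite ι] [Finite σ]
    {S : (ι → ℕ) → (σ → ℕ) → (σ → ℕ) → Prop}
    (hS : Checkable fun v : ι ⊕ (σ ⊕ σ) → ℕ => S (v ∘ inl) (v ∘ inr ∘ inl) (v ∘ inr ∘ inr)) :
    ∃ (κ : Type) (_ : Finite κ) (par : ι → κ) (cur : σ → κ) (B : (κ → ℕ) → (κ → ℕ) → Prop),
      (Sum.elim par cur).Injective ∧ Realizable B ∧
      (∀ x y, B x y → y ∘ par = x ∘ par ∧ S (x ∘ par) (x ∘ cur) (y ∘ cur)) ∧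
      ∀ x q, S (x ∘ par) (x ∘ cur) q → ∃ y, B x y ∧ y ∘ par = x ∘ par ∧ y ∘ cur = q := by
  obtain ⟨κ, _, h⟩ := hS
  let par : ι → (ι ⊕ (σ ⊕ σ)) ⊕ κ := inl ∘ inl
  let cur : σ → (ι ⊕ (σ ⊕ σ)) ⊕ κ := inl ∘ inr ∘ inl
  let next : σ → (ι ⊕ (σ ⊕ σ)) ⊕ κ := inl ∘ inr ∘ inr
  refine ⟨_, inferInstance, par, cur, _, ?_, (realizable_havoc (Set.range next)).comp
    (h.comp (realizable_assign (Set.range cur) cur next)), ?_, fun x q hq => ?_⟩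
  · rintro (i | i) (j | j) hij <;> simp_all [par, cur]
  · rintro x y ⟨z, hz, z', ⟨hz', hS⟩, hy, hcur⟩
    have hzx : z ∘ par = x ∘ par ∧ z ∘ cur = x ∘ cur :=
      ⟨funext fun i => hz _ (by simp [par, next]), funext fun i => hz _ (by simp [cur, next])⟩
    have hyz : y ∘ par = z' ∘ par ∧ y ∘ next = z' ∘ next :=
      ⟨funext fun i => hy _ (by simp [par, cur]), funext fun i => hy _ (by simp [cur, next])⟩
    have hzz' : z' ∘ par = z ∘ par ∧ z' ∘ next = z ∘ next :=
      ⟨congrArg (· ∘ inl) hz', congrArg (· ∘ inr ∘ inr) hz'⟩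
    change S (z ∘ par) (z ∘ cur) (z ∘ next) at hS
    rw [hyz.1, hzz'.1, hcur, hyz.2, hzz'.2, ← hzx.1, ← hzx.2]
    exact ⟨rfl, hS⟩
  · let z := Sum.elim (Sum.elim (x ∘ par) (Sum.elim (x ∘ cur) q)) (x ∘ inr)
    let y := Sum.elim (Sum.elim (x ∘ par) (Sum.elim q q)) (x ∘ inr)
    refine ⟨y, ⟨z, ?_, z, ⟨rfl, hq⟩, ?_, rfl⟩, rfl, rfl⟩
    · rintro ((i | i | i) | i) hi <;> first | rfl | exact absurd ⟨i, rfl⟩ hi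
    · rintro ((i | i | i) | i) hi <;> first | rfl | exact absurd ⟨i, rfl⟩ hi

theorem Checkable.reflTransGen [Finite ι] [Finite σ]
    {S : (ι → ℕ) → (σ → ℕ) → (σ → ℕ) → Prop}
    (hS : Checkable fun v : ι ⊕ (σ ⊕ σ) → ℕ => S (v ∘ inl) (v ∘ inr ∘ inl) (v ∘ inr ∘ inr)) :
    Checkable fun v : ι ⊕ (σ ⊕ σ) → ℕ =>
      Relation.ReflTransGen (S (v ∘ inl)) (v ∘ inr ∘ inl) (v ∘ inr ∘ inr) := by
  obtain ⟨κ, _, par, cur, B, hinj, hBr, hB, hB'⟩ := hS.exists_realizable_step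
  refine .of_realizable
    ((realizable_agree (inl ∘ Sum.elim inl (inr ∘ inl)) (inr ∘ Sum.elim par cur)).comp
      ((hBr.reflTransGen.map Sum.inr_injective).comp
        (realizable_agree (inl ∘ inr ∘ inr) (inr ∘ cur)))) ?_ fun v => ⟨fun h => ?_, ?_⟩
  · rintro x _ ⟨_, ⟨rfl, -⟩, y, ⟨-, hy⟩, rfl, -⟩
    exact funext fun i => hy _ (by simp)
  · obtain ⟨x, hx⟩ : ∃ x : κ → ℕ, x ∘ Sum.elim par cur = v ∘ Sum.elim inl (inr ∘ inl) :=
      ⟨_, Function.extend_comp hinj _ 0⟩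
    obtain ⟨hpar, hcur⟩ : x ∘ par = v ∘ inl ∧ x ∘ cur = v ∘ inr ∘ inl :=
      ⟨congrArg (· ∘ inl) hx, congrArg (· ∘ inr) hx⟩
    rw [← hpar, ← hcur] at h
    obtain ⟨y, hxy, -, hy⟩ := exists_reflTransGen_of_exists_step hB' h
    exact ⟨Sum.elim v x, Sum.elim v y, rfl, _, ⟨rfl, hx.symm⟩, Sum.elim v y,
      ⟨hxy, by simp⟩, rfl, hy.symm⟩
  · rintro ⟨x, _, rfl, _, ⟨rfl, hx⟩, y, ⟨hxy, hy⟩, rfl, hcur⟩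
    obtain ⟨hxpar, hxcur⟩ : x ∘ inl ∘ inl = x ∘ inr ∘ par ∧
        x ∘ inl ∘ inr ∘ inl = x ∘ inr ∘ cur :=
      ⟨congrArg (· ∘ inl) hx, congrArg (· ∘ inr) hx⟩
    have hy' : x ∘ inl ∘ inr ∘ inr = y ∘ inr ∘ cur :=
      (funext fun i => (hy _ (by simp)).symm).trans hcur
    have := (reflTransGen_of_forall_step hB hxy).2
    change Relation.ReflTransGen (S (x ∘ inl ∘ inl)) (x ∘ inl ∘ inr ∘ inl) (x ∘ inl ∘ inr ∘ inr)
    rwa [hxpar, hxcur, hy']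

end CheckableRelations

section PartialRecursiveFunctions

variable {ι : Type} {n m : ℕ}

open Sum (inl inr)
open Relation (ReflTransGen)

theorem mem_mOfFn {α : Type*} {g : Fin n → Part α} {v : List.Vector α n} :
    v ∈ List.Vector.mOfFn g ↔ ∀ i, v.get i ∈ g i := by
  induction n with
  | zero => simp [List.Vector.mOfFn, List.Vector.eq_nil v]
  | succ n ih =>
    simp only [List.Vector.mOfFn, Part.bind_eq_bind, Part.mem_bind_iff, Part.pure_eq_some,
      Part.mem_some_iff, ih, Fin.forall_fin_succ]
    constructor
    · rintro ⟨a, ha, w, hw, rfl⟩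
      simpa using ⟨ha, hw⟩
    · rintro ⟨h0, h1⟩
      exact ⟨v.head, by simpa using h0, v.tail, by simpa using h1, by simp⟩

/-- The graph of a partial function of `n` arguments is checkable, the value being stored in the
register `none` and the arguments in the other ones. -/
def GraphCheckable (f : List.Vector ℕ n →. ℕ) : Prop :=
  Checkable fun v : Option (Fin n) → ℕ => v none ∈ f (.ofFn fun i => v (some i))

namespace GraphCheckable

theorem comp_registers [Finite ι] {f : List.Vector ℕ n →. ℕ} (hf : GraphCheckable f) (c : ι)
    (a : Fin n → ι) : Checkable fun v : ι → ℕ => v c ∈ f (.ofFn fun i => v (a i)) :=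
  hf.comp (fun o => o.elim c a)

theorem comp {f : List.Vector ℕ m →. ℕ} {g : Fin m → List.Vector ℕ n →. ℕ}
    (hf : GraphCheckable f) (hg : ∀ i, GraphCheckable (g i)) :
    GraphCheckable fun v => (List.Vector.mOfFn fun i => g i v) >>= f := by
  refine (((Checkable.forall fun i => (hg i).comp_registers (inr i) (inl ∘ some)).and
    (hf.comp_registers (inl none) inr)).exists_elim).congr fun v => ?_
  refine Iff.trans ⟨?_, ?_⟩ Part.mem_bind_iff.symm
  · rintro ⟨u, hu, hv⟩
    exact ⟨.ofFn u, mem_mOfFn.2 fun i => by simpa using hu i, hv⟩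
  · rintro ⟨u, hu, hv⟩
    exact ⟨u.get, mem_mOfFn.1 hu, by simpa using hv⟩

theorem reflTransGen_iterate_iff {G : ℕ → ℕ → ℕ} {p q : Fin 2 → ℕ} (hp : p 0 = 0) :
    ReflTransGen (fun p q : Fin 2 → ℕ => q 0 = p 0 + 1 ∧ q 1 = G (p 0) (p 1)) p q ↔
      q 1 = (q 0).rec (p 1) G := by
  constructor
  · intro h
    induction h with
    | refl => rw [hp]; rfl
    | tail _ hqr ih => rw [hqr.2, hqr.1, ih]
  · intro h
    have key (k : ℕ) : ReflTransGen (fun p q : Fin 2 → ℕ => q 0 = p 0 + 1 ∧ q 1 = G (p 0) (p 1))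
        p ![k, k.rec (p 1) G] := by
      induction k with
      | zero =>
        convert ReflTransGen.refl using 1
        ext i
        fin_cases i <;> simp [hp]
      | succ k ih => exact ih.tail ⟨rfl, rfl⟩
    convert key (q 0)
    ext i
    fin_cases i <;> simp [h]

theorem prec {f : List.Vector ℕ n → ℕ} {g : List.Vector ℕ (n + 2) → ℕ}
    (hf : GraphCheckable fun v => Part.some (f v))
    (hg : GraphCheckable fun v => Part.some (g v)) :
    GraphCheckable fun v : List.Vector ℕ (n + 1) =>
      Part.some (v.head.rec (f v.tail) fun y IH => g (y ::ᵥ IH ::ᵥ v.tail)) := by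
  have hstep := ((checkable_eq_succ (inr (inr 0)) (inr (inl 0))).and
    (hg.comp_registers (ι := Option (Fin (n + 1)) ⊕ (Fin 2 ⊕ Fin 2)) (inr (inr 1))
      (Fin.cons (inr (inl 0)) (Fin.cons (inr (inl 1)) fun i => inl (some i.succ)))))
  have hloop := Checkable.reflTransGen (S := fun v p q => q 0 = p 0 + 1 ∧
    q 1 ∈ Part.some (g (p 0 ::ᵥ p 1 ::ᵥ .ofFn fun i => v (some i.succ)))) <|
    hstep.congr fun v => by simp [List.Vector.ofFn]
  refine ((hloop.and ((checkable_eq_zero (inr (inl 0))).and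
    ((hf.comp_registers (inr (inl 1)) fun i => inl (some i.succ)).and
    ((checkable_eq (inr (inr 0)) (inl (some 0))).and
    (checkable_eq (inr (inr 1)) (inl none)))))).exists_elim).congr fun v => ?_
  simp only [Part.mem_some_iff, Sum.elim_inr, Sum.elim_inl, Function.comp_def, List.Vector.ofFn,
    List.Vector.head_cons, List.Vector.tail_cons]
  let G (y z : ℕ) := g (y ::ᵥ z ::ᵥ .ofFn fun i => v (some i.succ))
  constructor
  · rintro ⟨u, hu, h0, hf, hk, hv⟩
    rw [← hv, ← hk, ← hf]
    exact (reflTransGen_iterate_iff (G := G) h0).1 hu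
  · intro hv
    exact ⟨Sum.elim ![0, _] ![_, _], (reflTransGen_iterate_iff (G := G) rfl).2 hv,
      rfl, rfl, rfl, rfl⟩

theorem eq_zero [Finite ι] {f : List.Vector ℕ n → ℕ}
    (hf : GraphCheckable (fun v => Part.some (f v))) (a : Fin n → ι) :
    Checkable fun v : ι → ℕ => f (.ofFn fun i => v (a i)) = 0 := by
  refine (((checkable_eq_zero (inr ())).and
    (hf.comp_registers (inr ()) (inl ∘ a))).exists_elim).congr fun v => ⟨?_, fun h => ?_⟩
  · rintro ⟨u, h0, hu⟩
    exact (Part.mem_some_iff.1 hu).symm.trans h0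
  · exact ⟨fun _ => 0, rfl, Part.mem_some_iff.2 h.symm⟩

theorem ne_zero [Finite ι] {f : List.Vector ℕ n → ℕ}
    (hf : GraphCheckable (fun v => Part.some (f v))) (a : Fin n → ι) :
    Checkable fun v : ι → ℕ => f (.ofFn fun i => v (a i)) ≠ 0 := by
  refine (((checkable_eq_succ (inr 0) (inr 1)).and
    (hf.comp_registers (inr (0 : Fin 2)) (inl ∘ a))).exists_elim).congr fun v => ⟨?_, fun h => ?_⟩
  · rintro ⟨u, hs, hu⟩
    exact (Part.mem_some_iff.1 hu).symm.trans_ne (hs.trans_ne (Nat.succ_ne_zero _))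
  · exact ⟨![_, Nat.pred _], (Nat.succ_pred h).symm, Part.mem_some _⟩

theorem reflTransGen_count_iff {P : ℕ → Prop} {p q : Unit → ℕ} (hp : p () = 0) :
    ReflTransGen (fun p q : Unit → ℕ => q () = p () + 1 ∧ P (p ())) p q ↔ ∀ j < q (), P j := by
  constructor
  · intro h
    induction h with
    | refl => simp [hp]
    | tail _ hqr ih =>
      rw [hqr.1]
      exact fun j hj => (Nat.lt_succ_iff_lt_or_eq.1 hj).elim (ih j) (· ▸ hqr.2)
  · intro h
    obtain rfl : p = fun _ => 0 := funext fun _ => hp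
    obtain ⟨k, rfl⟩ : ∃ k, q = fun _ => k := ⟨q (), rfl⟩
    induction k with
    | zero => exact .refl
    | succ k ih =>
      exact (ih fun j hj => h j (hj.trans k.lt_succ_self)).tail ⟨rfl, h k k.lt_succ_self⟩

theorem rfind {f : List.Vector ℕ (n + 1) → ℕ}
    (hf : GraphCheckable (fun v => Part.some (f v))) :
    GraphCheckable fun v => Nat.rfind fun k => Part.some (decide (f (k ::ᵥ v) = 0)) := by
  have hstep := (checkable_eq_succ (inr (inr ())) (inr (inl ()))).and
    (hf.ne_zero (ι := Option (Fin n) ⊕ (Unit ⊕ Unit))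
      (Fin.cons (inr (inl ())) fun i => inl (some i)))
  have hloop := Checkable.reflTransGen (S := fun v p q => q () = p () + 1 ∧
    f (p () ::ᵥ .ofFn fun i => v (some i)) ≠ 0) <|
    hstep.congr fun v => by simp [List.Vector.ofFn]
  refine ((hloop.and ((checkable_eq_zero (inr (inl ()))).and
    ((checkable_eq (inr (inr ())) (inl none)).and
    (hf.eq_zero (Fin.cons (inr (inr ())) fun i => inl (some i)))))).exists_elim).congr fun v => ?_
  let P (k : ℕ) := f (k ::ᵥ .ofFn fun i => v (some i)) ≠ 0
  refine Iff.trans ⟨?_, fun hv => ?_⟩ Nat.mem_rfind.symm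
  · rintro ⟨u, hu, h0, hk : u _ = v none, hf⟩
    have hlt := (reflTransGen_count_iff (P := P) h0).1 hu
    simp only [← hk]
    exact ⟨by simpa [List.Vector.ofFn] using hf, fun h => by simpa [P] using hlt _ h⟩
  · refine ⟨Sum.elim 0 fun _ => v none, (reflTransGen_count_iff (P := P) rfl).2 fun j hj => ?_,
      rfl, rfl, ?_⟩
    · simpa [P] using hv.2 hj
    · simpa [List.Vector.ofFn] using hv.1

end GraphCheckable

theorem graphCheckable_of_primrec' {f : List.Vector ℕ n → ℕ} (hf : Nat.Primrec' f) :
    GraphCheckable fun v => Part.some (f v) := by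
  induction hf with
  | zero => exact (checkable_eq_zero none).congr fun v => by simp
  | succ =>
    exact (checkable_eq_succ none (some 0)).congr fun v => by
      simp [List.Vector.head_ofFn]
  | get i => exact (checkable_eq none (some i)).congr fun v => by simp
  | comp _ _ _ ihf ihg =>
    simpa only [← Part.pure_eq_some, List.Vector.mOfFn_pure, pure_bind] using ihf.comp ihg
  | prec _ _ ihf ihg => exact ihf.prec ihg

theorem graphCheckable_of_partrec' {f : List.Vector ℕ n →. ℕ} (hf : Nat.Partrec' f) :
    GraphCheckable f := by
  induction hf with
  | prim h => exact graphCheckable_of_primrec' h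
  | comp g _ _ ihf ihg => exact ihf.comp ihg
  | rfind _ ih => exact ih.rfind

theorem exists_registerProgram {f : ℕ →. ℕ} (hf : Partrec f) :
    ∃ (ι : Type) (_ : Finite ι) (x : ℕ → ι → ℕ) (P : RegularExpression (Instr ι)),
      (∀ i, Primrec fun n => x n i) ∧ ∀ n, (∃ w ∈ P.matches', Passes w (x n)) ↔ (f n).Dom := by
  have hgraph := graphCheckable_of_partrec' (Nat.Partrec'.part_iff₁.2 hf)
  obtain ⟨κ, _, P, hP⟩ :=
    (hgraph.comp_registers (inr ()) fun _ => inl ()).exists_elim (ι := Unit) (σ := Unit)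
  let x (n : ℕ) : Unit ⊕ κ → ℕ := Sum.elim (fun _ => n) 0
  refine ⟨_, inferInstance, x, P, ?_, fun n => ?_⟩
  · rintro (_ | _)
    exacts [Primrec.id, Primrec.const 0]
  calc (∃ w ∈ P.matches', Passes w (x n)) ↔ ∃ y, Rel P (x n) y :=
        ⟨fun ⟨w, hw, h⟩ => ⟨_, w, hw, h, rfl⟩, fun ⟨_, w, hw, h, _⟩ => ⟨w, hw, h⟩⟩
    _ ↔ ∃ u : Unit → ℕ, u () ∈ f n :=
        ⟨fun ⟨y, h⟩ => ((hP _ y).1 h).2, fun h => ⟨x n, (hP _ _).2 ⟨rfl, h⟩⟩⟩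
    _ ↔ (f n).Dom :=
        ⟨fun ⟨u, h⟩ => Part.dom_iff_mem.2 ⟨_, h⟩, fun h => ⟨fun _ => _, Part.get_mem h⟩⟩

end PartialRecursiveFunctions

section MatrixThresholds

open Matrix

variable {Λ D R σ : Type} [Fintype σ] [DecidableEq σ]

/-- The product of a weighted automaton with a deterministic automaton. -/
def dfaMatrix [Zero R] (M : DFA Λ σ) (T : Λ → Matrix D D R) (l : Λ) :
    Matrix (σ × D) (σ × D) R :=
  fun d d' => if d'.1 = M.step d.1 l then T l d.2 d'.2 else 0

/-- The vector `v` in the block `s`, and `0` in the other blocks. -/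
def blockVec [Zero R] (s : σ) (v : D → R) (d : σ × D) : R := if d.1 = s then v d.2 else 0

variable [Fintype D]

theorem blockVec_dotProduct [NonUnitalNonAssocSemiring R] (s : σ) (v : D → R) (a : σ × D → R) :
    blockVec s v ⬝ᵥ a = v ⬝ᵥ fun d => a (s, d) := by
  simp only [dotProduct, blockVec, Fintype.sum_prod_type, ite_mul, zero_mul]
  rw [Finset.sum_comm]
  simp

variable [Semiring R]

theorem blockVec_vecMul_dfaMatrix (M : DFA Λ σ) (T : Λ → Matrix D D R)
    (l : Λ) (s : σ) (v : D → R) :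
    blockVec s v ᵥ* dfaMatrix M T l = blockVec (M.step s l) (v ᵥ* T l) := by
  ext ⟨t, d⟩
  rw [vecMul, blockVec_dotProduct]
  by_cases h : t = M.step s l <;> simp [blockVec, dfaMatrix, h, vecMul, dotProduct]

variable [DecidableEq D]

theorem blockVec_vecMul_prod (M : DFA Λ σ) (T : Λ → Matrix D D R)
    (w : List Λ) (s : σ) (v : D → R) :
    blockVec s v ᵥ* (w.map (dfaMatrix M T)).prod =
      blockVec (M.evalFrom s w) (v ᵥ* (w.map T).prod) := by
  induction w generalizing s v with
  | nil => simp
  | cons l w ih =>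
    simp only [List.map_cons, List.prod_cons, ← vecMul_vecMul, blockVec_vecMul_dfaMatrix, ih,
      DFA.evalFrom_cons]

/-- The word `w` takes the row vector `u` to a vector whose product with `a` exceeds its product
with `b`. -/
def ExceedsThreshold (T : Λ → Matrix D D ℕ) (u a b : D → ℕ) (w : List Λ) : Prop :=
  u ᵥ* (w.map T).prod ⬝ᵥ b < u ᵥ* (w.map T).prod ⬝ᵥ a

theorem exceedsThreshold_dfaMatrix (M : DFA Λ σ) (T : Λ → Matrix D D ℕ) (u a b : D → ℕ)
    (w : List Λ) :
    ExceedsThreshold (dfaMatrix M T) (blockVec M.start u)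
      (fun d => M.accept.indicator 1 d.1 * a d.2) (fun d => M.accept.indicator 1 d.1 * b d.2) w ↔
    w ∈ M.accepts ∧ ExceedsThreshold T u a b w := by
  simp only [ExceedsThreshold, blockVec_vecMul_prod, blockVec_dotProduct, DFA.mem_accepts, DFA.eval]
  by_cases hw : M.evalFrom M.start w ∈ M.accept <;> simp [hw, dotProduct]

end MatrixThresholds

section QuadraticSimulation

variable {ι : Type}

open Matrix Kronecker

/-- The values of the registers, preceded by the constant `1`. -/
def affine (x : ι → ℕ) (o : Option ι) : ℕ := o.elim 1 x

/-- The coordinates on which the matrices act: the products of two registers or constants, and the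
two accumulators, `true` for the positive and `false` for the negative parts of the penalties. -/
abbrev Mono (ι : Type) : Type := (Option ι × Option ι) ⊕ Bool

/-- The values of all coordinates. -/
def coords (x : ι → ℕ) (e : Bool → ℕ) : Mono ι → ℕ :=
  Sum.elim (fun p => affine x p.1 * affine x p.2) e

namespace Instr

instance [Finite ι] : Finite (Instr ι) :=
  .of_surjective (Sum.elim inc (Sum.elim clr fun p : ι × ι => eq p.1 p.2)) <| by
    rintro (i | i | ⟨i, j⟩)
    exacts [⟨.inl i, rfl⟩, ⟨.inr (.inl i), rfl⟩, ⟨.inr (.inr (i, j)), rfl⟩]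

/-- The increments of the two accumulators caused by an instruction. -/
def penalty : Instr ι → (ι → ℕ) → Bool → ℕ
  | eq i j, x, true => x i * x i + x j * x j
  | eq i j, x, false => x i * x j + x j * x i
  | _, _, _ => 0

theorem penalty_le (l : Instr ι) (x : ι → ℕ) : l.penalty x false ≤ l.penalty x true := by
  cases l with
  | eq i j =>
    simp only [penalty]
    zify
    nlinarith [sq_nonneg ((x i : ℤ) - x j)]
  | _ => exact le_rfl

theorem penalty_true_le_iff {l : Instr ι} {x : ι → ℕ} :
    l.penalty x true ≤ l.penalty x false ↔ l.Ok x := by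
  cases l with
  | eq i j =>
    have h : (x i : ℤ) * x i + x j * x j ≤ x i * x j + x j * x i ↔ ((x i : ℤ) - x j) ^ 2 ≤ 0 := by
      rw [← sub_nonpos]; ring_nf
    simp only [penalty, Ok]
    zify
    rw [h, sq_nonpos_iff, sub_eq_zero]
  | _ => exact iff_of_true le_rfl trivial

variable [DecidableEq ι]

/-- The matrix of the affine action of an instruction on the registers. -/
def matrix : Instr ι → Matrix (Option ι) (Option ι) ℕ
  | inc i => 1 + .single none (some i) 1
  | clr i => .diagonal fun o => if o = some i then 0 else 1
  | eq _ _ => 1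

/-- The quadratic form that an instruction adds to an accumulator. The two forms of `eq i j` are the
positive and the negative part of the square of `x i - x j`. -/
def form : Instr ι → Bool → Option ι × Option ι → ℕ
  | eq i j, true => Pi.single (some i, some i) 1 + Pi.single (some j, some j) 1
  | eq i j, false => Pi.single (some i, some j) 1 + Pi.single (some j, some i) 1
  | _, _ => 0

/-- The matrix of the action of an instruction on all coordinates. -/
def monoMatrix (l : Instr ι) : Matrix (Mono ι) (Mono ι) ℕ :=
  .fromBlocks (l.matrix ⊗ₖ l.matrix) (.of fun p b => l.form b p) 0 1

variable [Fintype ι]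

theorem affine_vecMul_matrix (l : Instr ι) (x : ι → ℕ) :
    affine x ᵥ* l.matrix = affine (l.act x) := by
  classical
  cases l with
  | inc i =>
    rw [matrix, vecMul_add, vecMul_one]
    ext (_ | j)
    · simp [affine, vecMul, dotProduct]
    · by_cases h : j = i <;>
        simp [affine, act, vecMul, dotProduct, single_apply, h, eq_comm (a := i)]
  | clr i =>
    ext (_ | j)
    · simp [matrix, vecMul_diagonal, affine, act]
    · by_cases h : j = i <;> simp [matrix, vecMul_diagonal, affine, act, h]
  | eq i j => simp [matrix, act]

theorem affine_mul_dotProduct_form (l : Instr ι) (x : ι → ℕ) (b : Bool) :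
    (fun p : Option ι × Option ι => affine x p.1 * affine x p.2) ⬝ᵥ l.form b = l.penalty x b := by
  cases l <;> cases b <;> simp [form, penalty, affine, dotProduct_add]

theorem coords_vecMul_monoMatrix (l : Instr ι) (x : ι → ℕ) (e : Bool → ℕ) :
    coords x e ᵥ* l.monoMatrix = coords (l.act x) (l.penalty x + e) := by
  rw [monoMatrix, coords, vecMul_fromBlocks]
  funext o
  rcases o with ⟨t, t'⟩ | b
  · simp only [coords, ← affine_vecMul_matrix, vecMul_zero, add_zero, Sum.elim_inl, vecMul,
      dotProduct, Fintype.sum_prod_type, Finset.sum_mul_sum, kronecker_apply, mul_mul_mul_comm,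
      Function.comp_apply]
  · have h := l.affine_mul_dotProduct_form x b
    simp only [coords, vecMul_one, Sum.elim_inr, Pi.add_apply, ← h]
    rfl

end Instr

/-- The total increments of the accumulators caused by a sequence of instructions. -/
noncomputable def penalty : List (Instr ι) → (ι → ℕ) → Bool → ℕ
  | [], _ => 0
  | l :: w, x => l.penalty x + penalty w (l.act x)

theorem penalty_le (w : List (Instr ι)) (x : ι → ℕ) : penalty w x false ≤ penalty w x true := by
  induction w generalizing x with
  | nil => exact le_rfl
  | cons l w ih => exact add_le_add (l.penalty_le x) (ih _)

theorem penalty_true_le_iff {w : List (Instr ι)} {x : ι → ℕ} :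
    penalty w x true ≤ penalty w x false ↔ Passes w x := by
  induction w generalizing x with
  | nil => exact iff_of_true le_rfl trivial
  | cons l w ih =>
    have hl := l.penalty_le x
    have hw := penalty_le w (l.act x)
    rw [Passes, ← ih, ← Instr.penalty_true_le_iff]
    simp only [penalty, Pi.add_apply]
    lia

variable [DecidableEq ι] [Fintype ι]

theorem coords_vecMul_prod (w : List (Instr ι)) (x : ι → ℕ) (e : Bool → ℕ) :
    coords x e ᵥ* (w.map Instr.monoMatrix).prod = coords (run w x) (penalty w x + e) := by
  induction w generalizing x e with
  | nil => simp [run, penalty]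
  | cons l w ih =>
    rw [List.map_cons, List.prod_cons, ← vecMul_vecMul, Instr.coords_vecMul_monoMatrix, ih, penalty,
      ← add_assoc, add_comm (penalty _ _)]
    rfl

theorem exceedsThreshold_monoMatrix_iff {w : List (Instr ι)} {x : ι → ℕ} :
    ExceedsThreshold Instr.monoMatrix (coords x 0)
      (Pi.single (.inl (none, none)) 1 + Pi.single (.inr false) 1) (Pi.single (.inr true) 1) w ↔
    Passes w x := by
  rw [ExceedsThreshold, coords_vecMul_prod, dotProduct_add, ← penalty_true_le_iff,
    ← Nat.lt_one_add_iff]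
  simp [coords, affine]

theorem exists_exceedsThreshold_iff_dom {f : ℕ →. ℕ} (hf : Partrec f) :
    ∃ (Λ D : Type) (_ : Finite Λ) (_ : Fintype D) (_ : DecidableEq D) (T : Λ → Matrix D D ℕ)
      (u : ℕ → D → ℕ) (a b : D → ℕ), (∀ d, Primrec fun n => u n d) ∧ (∀ n, u n ≠ 0) ∧
      ∀ n, (∃ w, ExceedsThreshold T (u n) a b w) ↔ (f n).Dom := by
  classical
  obtain ⟨ι, _, x, P, hx, hP⟩ := exists_registerProgram hf
  obtain ⟨σ, _, M, hM⟩ := isRegular_matches' P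
  have := Fintype.ofFinite ι
  have haffine (o : Option ι) : Primrec fun n => affine (x n) o := by
    cases o
    exacts [Primrec.const 1, hx _]
  refine ⟨Instr ι, σ × Mono ι, inferInstance, inferInstance, inferInstance,
    dfaMatrix M Instr.monoMatrix, fun n => blockVec M.start (coords (x n) 0),
    fun d => M.accept.indicator 1 d.1 *
      (Pi.single (.inl (none, none)) 1 + Pi.single (.inr false) 1 : Mono ι → ℕ) d.2,
    fun d => M.accept.indicator 1 d.1 * (Pi.single (.inr true) 1 : Mono ι → ℕ) d.2,
    ?_, fun n h => ?_, fun n => (exists_congr fun w => ?_).trans (hP n)⟩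
  · rintro ⟨s, p | b⟩ <;> simp only [blockVec] <;> split_ifs
    exacts [Primrec.nat_mul.comp (haffine _) (haffine _), Primrec.const 0, Primrec.const 0,
      Primrec.const 0]
  · simpa [blockVec, coords, affine] using congrFun h (M.start, .inl (none, none))
  · rw [exceedsThreshold_dfaMatrix, hM, exceedsThreshold_monoMatrix_iff]

end QuadraticSimulation

section Observations

open MeasureTheory ProbabilityTheory

section Prediction

variable {S S' Obs R R' : Type*} [Fintype S] [Fintype S'] [DecidableEq Obs] [Semiring R]
  [Semiring R']

/-- The joint weight of the history `h` of observations at times `0, …, m - 1`, where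
`m = h.length`, and of being in state `t` at time `m`. Histories list the latest observation
first. -/
def predict (init : S → R) (trans : S → S → R) (obs : S → Obs) : List Obs → S → R
  | [], t => init t
  | o :: h, t => ∑ s with obs s = o, predict init trans obs h s * trans s t

theorem predict_nonneg [PartialOrder R] [IsOrderedRing R] {init : S → R} {trans : S → S → R}
    (hinit : ∀ s, 0 ≤ init s) (htrans : ∀ s t, 0 ≤ trans s t) (obs : S → Obs) (h : List Obs)
    (t : S) : 0 ≤ predict init trans obs h t := by
  induction h generalizing t with
  | nil => exact hinit t
  | cons o h ih => exact Finset.sum_nonneg fun s _ => mul_nonneg (ih s) (htrans s t)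

theorem map_predict (f : R →+* R') (init : S → R) (trans : S → S → R) (obs : S → Obs)
    (h : List Obs) (t : S) :
    f (predict init trans obs h t) =
      predict (fun s => f (init s)) (fun s t => f (trans s t)) obs h t := by
  induction h generalizing t with
  | nil => rfl
  | cons o h ih => simp only [predict, map_sum, map_mul, ih]

theorem predict_comp_equiv (e : S' ≃ S) (init : S → R) (trans : S → S → R) (obs : S → Obs)
    (h : List Obs) (t : S') :
    predict (fun s => init (e s)) (fun s t => trans (e s) (e t)) (fun s => obs (e s)) h t =
      predict init trans obs h (e t) := by
  induction h generalizing t with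
  | nil => rfl
  | cons o h ih =>
    simp only [predict, ih, Finset.sum_filter]
    exact e.sum_comp fun s => if obs s = o then predict init trans obs h s * trans s (e t) else 0

end Prediction

section Histories

variable {S Obs : Type*}

/-- The observations along `ρ` at times `0, …, m - 1`, latest first. -/
def history (obs : S → Obs) (ρ : ℕ → S) : ℕ → List Obs
  | 0 => []
  | m + 1 => obs (ρ m) :: history obs ρ m

theorem history_length (obs : S → Obs) (ρ : ℕ → S) (m : ℕ) : (history obs ρ m).length = m := by
  induction m with
  | zero => rfl
  | succ m ih => rw [history, List.length_cons, ih]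

theorem ofFn_obs_eq_reverse_history (obs : S → Obs) (ρ : ℕ → S) (m : ℕ) :
    (List.ofFn fun j : Fin m => obs (ρ j)) = (history obs ρ m).reverse := by
  induction m with
  | zero => rfl
  | succ m ih =>
    rw [history, List.reverse_cons, ← ih, List.ofFn_succ', List.concat_eq_append]
    rfl

theorem history_congr (obs : S → Obs) {ρ ρ' : ℕ → S} {m : ℕ} (h : ∀ j < m, ρ j = ρ' j) :
    history obs ρ m = history obs ρ' m := by
  induction m with
  | zero => rfl
  | succ m ih =>
    rw [history, history, h m m.lt_succ_self, ih fun j hj => h j (Nat.lt_succ_of_lt hj)]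

theorem exists_preimage_frestrictLe {A : Set (ℕ → S)} {m : ℕ}
    (hA : DependsOn (· ∈ A) (Set.Iic m)) :
    ∃ E : Set (Finset.Iic m → S), A = Preorder.frestrictLe m ⁻¹' E := by
  refine ⟨Preorder.frestrictLe m '' A, (Set.subset_preimage_image _ _).antisymm ?_⟩
  rintro ρ ⟨ρ', hρ', h⟩
  exact (hA fun j hj => congrFun h ⟨j, Finset.mem_Iic.2 hj⟩).mp hρ'

theorem measurableSet_of_dependsOn [Finite S] [MeasurableSpace S] [DiscreteMeasurableSpace S]
    {A : Set (ℕ → S)} {m : ℕ} (hA : DependsOn (· ∈ A) (Set.Iic m)) : MeasurableSet A := by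
  obtain ⟨E, rfl⟩ := exists_preimage_frestrictLe hA
  exact Preorder.measurable_frestrictLe m MeasurableSet.of_discrete

end Histories

theorem lt_div_iff_of_le {K : Type*} [Field K] [LinearOrder K] [IsStrictOrderedRing K] {a b c : K}
    (hc : 0 ≤ c) (ha : 0 ≤ a) (hab : a ≤ b) : c < a / b ↔ c * b < a := by
  obtain rfl | hb := (ha.trans hab).eq_or_lt
  · simp [hab.antisymm ha, hc]
  · exact lt_div_iff₀ hb

namespace PODTMC

variable {Agt S Obs AP : Type} [Fintype S] [MeasurableSpace S] [DiscreteMeasurableSpace S]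

instance (M : PODTMC Agt S Obs AP) : IsProbabilityMeasure M.initPMF.toMeasure :=
  PMF.toMeasure.isProbabilityMeasure _

instance (M : PODTMC Agt S Obs AP) : IsProbabilityMeasure M.seqMeasure := by
  unfold seqMeasure; infer_instance

theorem seqMeasure_zero (M : PODTMC Agt S Obs AP) (s : S) :
    M.seqMeasure {ρ | ρ 0 = s} = ENNReal.ofReal (M.init s) := by
  have h : M.seqMeasure.map (Preorder.frestrictLe (π := fun _ => S) 0) =
      M.initPMF.toMeasure.map (MeasurableEquiv.piUnique fun _ : Finset.Iic 0 => S).symm := by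
    rw [seqMeasure, Kernel.trajMeasure, Measure.map_comp _ _ (by fun_prop),
      Kernel.traj_map_frestrictLe, Kernel.partialTraj_self, Measure.id_comp]
  have h' := DFunLike.congr_fun h {x | x ⟨0, Finset.mem_Iic.2 le_rfl⟩ = s}
  rw [Measure.map_apply (by fun_prop) MeasurableSet.of_discrete,
    Measure.map_apply (MeasurableEquiv.measurable _) MeasurableSet.of_discrete] at h'
  exact h'.trans (PMF.toMeasure_apply_singleton _ s (measurableSet_singleton s))

theorem seqMeasure_inter_succ (M : PODTMC Agt S Obs AP) {m : ℕ} {s : S} {A : Set (ℕ → S)}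
    (hA : DependsOn (· ∈ A) (Set.Iic m)) (hs : ∀ ρ ∈ A, ρ m = s) (t : S) :
    M.seqMeasure (A ∩ {ρ | ρ (m + 1) = t}) = M.seqMeasure A * ENNReal.ofReal (M.trans s t) := by
  obtain ⟨E, rfl⟩ := exists_preimage_frestrictLe hA
  have : Nonempty S := ⟨t⟩
  have hE : ∀ x ∈ E, x ⟨m, Finset.mem_Iic.2 le_rfl⟩ = s := by
    intro x hx
    obtain ⟨ρ, rfl⟩ : ∃ ρ : ℕ → S, Preorder.frestrictLe m ρ = x :=
      ⟨fun j => if hj : j ≤ m then x ⟨j, Finset.mem_Iic.2 hj⟩ else t,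
        funext fun j => dif_pos (Finset.mem_Iic.1 j.2)⟩
    exact hs ρ hx
  have h := DFunLike.congr_fun (Kernel.map_frestrictLe_trajMeasure_compProd_eq_map_trajMeasure
    (X := fun _ => S) (κ := M.histKernel) (μ₀ := M.initPMF.toMeasure) (a := m)) (E ×ˢ {t})
  rw [Measure.map_apply (by fun_prop) MeasurableSet.of_discrete,
    Measure.compProd_apply_prod MeasurableSet.of_discrete MeasurableSet.of_discrete] at h
  refine h.symm.trans ?_
  rw [setLIntegral_congr_fun (g := fun _ => ENNReal.ofReal (M.trans s t)) MeasurableSet.of_discrete,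
    setLIntegral_const, Measure.map_apply (by fun_prop) MeasurableSet.of_discrete, mul_comm]
  · rfl
  · intro x hx
    change (M.stepPMF (x ⟨m, Finset.mem_Iic.2 le_rfl⟩)).toMeasure {t} = _
    rw [hE x hx, PMF.toMeasure_apply_singleton _ _ (measurableSet_singleton t)]
    rfl

theorem seqMeasure_eval_mem_inter (M : PODTMC Agt S Obs AP) (m : ℕ) (T : Finset S)
    (A : Set (ℕ → S)) :
    M.seqMeasure ({ρ | ρ m ∈ T} ∩ A) = ∑ t ∈ T, M.seqMeasure ({ρ | ρ m = t} ∩ A) := by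
  have hT (T : Set S) : MeasurableSet ((fun ρ : ℕ → S => ρ m) ⁻¹' T) :=
    measurable_pi_apply m MeasurableSet.of_discrete
  refine (Measure.restrict_apply (hT T)).symm.trans ?_
  rw [← sum_measure_preimage_singleton T fun t _ => hT {t}]
  exact Finset.sum_congr rfl fun t _ => Measure.restrict_apply (hT {t})

theorem ae_isPath (M : PODTMC Agt S Obs AP) : ∀ᵐ ρ ∂M.seqMeasure, M.IsPath ρ := by
  have hinit : ∀ᵐ ρ ∂M.seqMeasure, ∀ s, M.init s = 0 → ρ 0 ≠ s := by
    refine ae_all_iff.2 fun s => ae_all_iff.2 fun hs => ?_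
    simpa [ae_iff, hs] using M.seqMeasure_zero s
  have htrans : ∀ᵐ ρ ∂M.seqMeasure, ∀ m s t, M.trans s t = 0 → ¬ (ρ m = s ∧ ρ (m + 1) = t) := by
    simp only [ae_all_iff]
    intro m s t h
    have hm := M.seqMeasure_inter_succ (m := m) (s := s) (A := {ρ | ρ m = s})
      (fun ρ ρ' hρ => congrArg (· = s) (hρ m Set.self_mem_Iic)) (fun _ => id) t
    rw [h, ENNReal.ofReal_zero, mul_zero] at hm
    simpa only [ae_iff, not_not, Set.ofPred_and] using hm
  filter_upwards [hinit, htrans] with ρ h0 h1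
  exact ⟨fun h => h0 _ h rfl,
    fun m => (M.trans_nonneg _ _).lt_of_ne' fun h => h1 m _ _ h ⟨rfl, rfl⟩⟩

theorem measurableSet_isPath (M : PODTMC Agt S Obs AP) : MeasurableSet {ρ | M.IsPath ρ} := by
  have hinit : MeasurableSet {ρ : ℕ → S | M.init (ρ 0) ≠ 0} :=
    measurableSet_of_dependsOn (m := 0) fun _ _ h => congrArg (M.init · ≠ 0) (h 0 Set.self_mem_Iic)
  have htrans (m : ℕ) : MeasurableSet {ρ : ℕ → S | 0 < M.trans (ρ m) (ρ (m + 1))} :=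
    measurableSet_of_dependsOn (m := m + 1) fun _ _ h => congrArg₂ (0 < M.trans · ·)
      (h m (Set.mem_Iic.2 m.le_succ)) (h (m + 1) Set.self_mem_Iic)
  simpa only [IsPath, Set.ofPred_and, Set.ofPred_forall] using hinit.inter (.iInter htrans)

theorem pathMeasure_apply (M : PODTMC Agt S Obs AP) (A : Set (ℕ → S)) :
    M.pathMeasure (Subtype.val ⁻¹' A) = M.seqMeasure A := by
  refine ((MeasurableEmbedding.subtype_coe M.measurableSet_isPath).comap_apply _ _).trans ?_
  refine (congrArg M.seqMeasure (Subtype.image_preimage_coe {ρ | M.IsPath ρ} A)).trans ?_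
  rw [Set.inter_comm]
  exact measure_inter_conull (ae_iff.1 M.ae_isPath)

theorem exists_path_mem (M : PODTMC Agt S Obs AP) {A : Set (ℕ → S)} (hA : M.seqMeasure A ≠ 0) :
    ∃ ρ : M.Path, ρ.1 ∈ A :=
  nonempty_of_measure_ne_zero (M.pathMeasure_apply A ▸ hA)

theorem sprSystem_prior_apply (M : PODTMC Agt S Obs AP) {A : Set (ℕ → S)} (hA : MeasurableSet A)
    {B : Set M.sprSystem.runs} (hB : ∀ ρ : M.Path, M.toSprRuns ρ ∈ B ↔ ρ.1 ∈ A) :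
    M.sprSystem.prior B = M.seqMeasure A := by
  have hpre : M.toSprRuns ⁻¹' B = Subtype.val ⁻¹' A := Set.ext hB
  have hmeas : @Measurable _ _ _ (MeasurableSpace.map M.toSprRuns inferInstance) M.toSprRuns :=
    fun _ h => h
  have hmB : MeasurableSet[MeasurableSpace.map M.toSprRuns inferInstance] B := by
    change MeasurableSet (M.toSprRuns ⁻¹' B)
    exact hpre ▸ measurable_subtype_coe hA
  rw [← pathMeasure_apply, ← hpre]
  exact @Measure.map_apply _ _ _ (MeasurableSpace.map M.toSprRuns inferInstance) _ _ hmeas _ hmB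

theorem localState_eq_iff (M : PODTMC Agt S Obs AP) (i : Agt) (ρ ρ' : M.Path) (m m' : ℕ) :
    M.sprSystem.localState i (M.toSprRuns ρ', m') = M.sprSystem.localState i (M.toSprRuns ρ, m) ↔
      history (M.obs i) ρ'.1 (m' + 1) = history (M.obs i) ρ.1 (m + 1) := by
  simp only [PriorSystem.localState, toSprRuns, sprRun, ofFn_obs_eq_reverse_history,
    List.reverse_inj]

theorem sprModels_ex_iff (M : PODTMC Agt S Obs AP) (φ : Formula Agt AP) {s₀ : S}
    (hs₀ : ∀ s, s ≠ s₀ → M.init s = 0) :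
    M.SprModels (.ex φ) ↔ ∃ ρ : M.Path, Sat M.sprSystem φ (M.toSprRuns ρ, 0) := by
  have hstart (ρ : M.Path) : M.sprRun ρ.1 0 = (s₀, fun a => [M.obs a s₀]) := by
    have h : ρ.1 0 = s₀ := not_not.1 fun h => ρ.2.1 (hs₀ _ h)
    simp [sprRun, h]
  have hex (ρ : M.Path) : Sat M.sprSystem (.ex φ) (M.toSprRuns ρ, 0) ↔
      ∃ ρ : M.Path, Sat M.sprSystem φ (M.toSprRuns ρ, 0) := by
    simp only [Formula.ex, Sat, Nat.le_zero, forall_eq, not_forall, not_not, exists_prop]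
    constructor
    · rintro ⟨⟨_, ρ', rfl⟩, -, h⟩
      exact ⟨ρ', h⟩
    · rintro ⟨ρ', h⟩
      exact ⟨M.toSprRuns ρ', (hstart ρ').trans (hstart ρ).symm, h⟩
  obtain ⟨ρ₀, -⟩ := M.exists_path_mem (A := Set.univ) (by simp)
  refine ⟨fun h => (hex ρ₀).1 (h _), ?_⟩
  rintro h ⟨_, ρ, rfl⟩
  exact (hex ρ).2 h

variable [DecidableEq Obs]

theorem seqMeasure_eval_inter_history (M : PODTMC Agt S Obs AP) (i : Agt) (h : List Obs) (t : S) :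
    M.seqMeasure ({ρ | ρ h.length = t} ∩ {ρ | history (M.obs i) ρ h.length = h}) =
      ENNReal.ofReal (predict M.init M.trans (M.obs i) h t) := by
  have hnn := predict_nonneg M.init_nonneg M.trans_nonneg (M.obs i)
  induction h generalizing t with
  | nil => simpa [history, predict] using M.seqMeasure_zero t
  | cons o h ih =>
    rw [predict, ENNReal.ofReal_sum_of_nonneg fun s _ => mul_nonneg (hnn h s) (M.trans_nonneg s t)]
    have hset : {ρ | ρ (o :: h).length = t} ∩ {ρ | history (M.obs i) ρ (o :: h).length = o :: h} =
        {ρ | ρ h.length ∈ Finset.univ.filter fun s => M.obs i s = o} ∩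
          ({ρ | history (M.obs i) ρ h.length = h} ∩ {ρ | ρ (h.length + 1) = t}) := by
      ext ρ
      simp [history, and_comm, and_assoc]
    rw [hset, seqMeasure_eval_mem_inter]
    refine Finset.sum_congr rfl fun s _ => ?_
    rw [ENNReal.ofReal_mul (hnn h s), ← ih, ← Set.inter_assoc]
    refine M.seqMeasure_inter_succ (fun ρ ρ' hρ => ?_) (fun ρ hρ => hρ.1) t
    change (_ = s ∧ _ = h) = (_ = s ∧ _ = h)
    rw [hρ h.length Set.self_mem_Iic,
      history_congr (M.obs i) fun j hj => hρ j (Set.mem_Iic.2 hj.le)]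

theorem seqMeasure_history (M : PODTMC Agt S Obs AP) (i : Agt) (o : Obs) (h : List Obs)
    (P : S → Prop) [DecidablePred P] :
    M.seqMeasure {ρ | history (M.obs i) ρ (h.length + 1) = o :: h ∧ P (ρ h.length)} =
      ENNReal.ofReal (∑ t with M.obs i t = o ∧ P t, predict M.init M.trans (M.obs i) h t) := by
  rw [ENNReal.ofReal_sum_of_nonneg fun t _ =>
    predict_nonneg M.init_nonneg M.trans_nonneg (M.obs i) h t]
  simp only [← seqMeasure_eval_inter_history, ← seqMeasure_eval_mem_inter]
  congr 1
  ext ρ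
  simp [history, and_left_comm, and_comm]

theorem prior_runsThrough (M : PODTMC Agt S Obs AP) (i : Agt) (ρ : M.Path) (m : ℕ)
    (P : S → Prop) [DecidablePred P] :
    M.sprSystem.prior (M.sprSystem.runsThrough
      {y | y ∈ M.sprSystem.indist i (M.toSprRuns ρ, m) ∧ P (y.1.1 y.2).1}) =
    ENNReal.ofReal (∑ t with M.obs i t = M.obs i (ρ.1 m) ∧ P t,
      predict M.init M.trans (M.obs i) (history (M.obs i) ρ.1 m) t) := by
  rw [← seqMeasure_history, history_length]
  refine M.sprSystem_prior_apply (measurableSet_of_dependsOn (m := m) fun ρ' ρ'' h => ?_)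
    fun ρ' => ⟨?_, fun h => ⟨m, (M.localState_eq_iff i ρ ρ' m m).2 h.1, h.2⟩⟩
  · change (_ ∧ _) = (_ ∧ _)
    rw [history_congr (M.obs i) fun j hj => h j (Nat.le_of_lt_succ hj), h m Set.self_mem_Iic]
  · rintro ⟨m', h, hP⟩
    have hh := (M.localState_eq_iff i ρ ρ' m m').1 h
    obtain rfl : m' = m := by simpa [history_length] using congrArg List.length hh
    exact ⟨hh, hP⟩

theorem agentProb_atom (M : PODTMC Agt S Obs AP) (i : Agt) (p : AP)
    [DecidablePred fun s => p ∈ M.val s] (ρ : M.Path) (m : ℕ) :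
    M.sprSystem.agentProb i (M.toSprRuns ρ, m)
      {y | y ∈ M.sprSystem.indist i (M.toSprRuns ρ, m) ∧ Sat M.sprSystem (.atom p) y} =
    (∑ t with M.obs i t = M.obs i (ρ.1 m) ∧ p ∈ M.val t,
        predict M.init M.trans (M.obs i) (history (M.obs i) ρ.1 m) t) /
      ∑ t with M.obs i t = M.obs i (ρ.1 m),
        predict M.init M.trans (M.obs i) (history (M.obs i) ρ.1 m) t := by
  have hnn (T : Finset S) (h : List Obs) :
      0 ≤ ∑ t ∈ T, predict M.init M.trans (M.obs i) h t :=
    Finset.sum_nonneg fun t _ => predict_nonneg M.init_nonneg M.trans_nonneg _ h t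
  have hp := M.prior_runsThrough i ρ m (p ∈ M.val ·)
  have htrue := M.prior_runsThrough i ρ m fun _ => True
  simp only [and_true] at htrue
  have hsub : M.sprSystem.runsThrough {y | y ∈ M.sprSystem.indist i (M.toSprRuns ρ, m) ∧
      Sat M.sprSystem (.atom p) y} ⊆
      M.sprSystem.runsThrough (M.sprSystem.indist i (M.toSprRuns ρ, m)) :=
    fun r ⟨m', h⟩ => ⟨m', h.1⟩
  rw [PriorSystem.agentProb, Set.inter_eq_left.2 hsub]
  simp only [Sat]
  refine (congrArg₂ (·.toReal / ·.toReal) hp htrue).trans ?_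
  rw [ENNReal.toReal_ofReal (hnn _ _), ENNReal.toReal_ofReal (hnn _ _)]

theorem sat_eventually_probGt_iff (M : PODTMC Agt S Obs AP) (i : Agt) (p : AP)
    [DecidablePred fun s => p ∈ M.val s] {c : ℚ} (hc : 0 ≤ c) (ρ : M.Path) :
    Sat M.sprSystem (.eventually (.probGt i (.atom p) c)) (M.toSprRuns ρ, 0) ↔
    ∃ m, c * ∑ t with M.obs i t = M.obs i (ρ.1 m),
        predict M.init M.trans (M.obs i) (history (M.obs i) ρ.1 m) t <
      ∑ t with M.obs i t = M.obs i (ρ.1 m) ∧ p ∈ M.val t,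
        predict M.init M.trans (M.obs i) (history (M.obs i) ρ.1 m) t := by
  rw [Formula.eventually, Sat]
  refine exists_congr fun m => ?_
  have hnn := predict_nonneg M.init_nonneg M.trans_nonneg (M.obs i) (history (M.obs i) ρ.1 m)
  rw [← lt_div_iff_of_le (by exact_mod_cast hc) (Finset.sum_nonneg fun t _ => hnn t),
    ← agentProb_atom, Formula.probGt, Sat]
  · simp [termVal, Cmp.Holds, Formula.top, Sat]
  · exact Finset.sum_le_sum_of_subset_of_nonneg
      (Finset.monotone_filter_right _ fun _ _ => And.left) fun t _ _ => hnn t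

theorem sprModels_ex_eventually_probGt_iff (M : PODTMC Agt S Obs AP) (i : Agt) (p : AP)
    [DecidablePred fun s => p ∈ M.val s] {c : ℚ} (hc : 0 ≤ c) {s₀ : S}
    (hs₀ : ∀ s, s ≠ s₀ → M.init s = 0) :
    M.SprModels (.ex (.eventually (.probGt i (.atom p) c))) ↔
    ∃ o h, c * ∑ t with M.obs i t = o, predict M.init M.trans (M.obs i) h t <
      ∑ t with M.obs i t = o ∧ p ∈ M.val t, predict M.init M.trans (M.obs i) h t := by
  simp only [M.sprModels_ex_iff _ hs₀, M.sat_eventually_probGt_iff i p hc]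
  refine ⟨fun ⟨ρ, m, h⟩ => ⟨_, _, h⟩, fun ⟨o, h, hlt⟩ => ?_⟩
  have hpos : 0 < ∑ t with M.obs i t = o ∧ p ∈ M.val t, predict M.init M.trans (M.obs i) h t :=
    (mul_nonneg (by exact_mod_cast hc) (Finset.sum_nonneg fun t _ =>
      predict_nonneg M.init_nonneg M.trans_nonneg _ h t)).trans_lt hlt
  rw [← ENNReal.ofReal_pos, ← seqMeasure_history] at hpos
  obtain ⟨ρ, hρ, -⟩ := M.exists_path_mem hpos.ne'
  obtain ⟨ho, hh⟩ := List.cons.inj hρ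
  refine ⟨ρ, h.length, ?_⟩
  rwa [ho, hh]

end PODTMC

end Observations

theorem FinitePODTMC.sprModels_ex_eventually_probGt_iff {n k : ℕ} (M : FinitePODTMC n k)
    (i : Fin n) (p : Fin k) {c : ℚ} (hc : 0 ≤ c) {s₀ : Fin M.size}
    (hs₀ : ∀ s, s ≠ s₀ → M.init s = 0) :
    M.toPODTMC.SprModels (.ex (.eventually (.probGt i (.atom p) c))) ↔
    ∃ o h, c * ∑ t with M.obs i t = o, predict M.init M.trans (M.obs i) h t <
      ∑ t with M.obs i t = o ∧ M.val t p, predict M.init M.trans (M.obs i) h t := by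
  classical
  rw [M.toPODTMC.sprModels_ex_eventually_probGt_iff i p hc (s₀ := s₀)
    fun s hs => Rat.cast_eq_zero.2 (hs₀ s hs)]
  have hcast (h : List ℕ) (t : Fin M.size) :
      predict M.toPODTMC.init M.toPODTMC.trans (M.toPODTMC.obs i) h t =
        (predict M.init M.trans (M.obs i) h t : ℚ) :=
    (map_predict (Rat.castHom ℝ) M.init M.trans (M.obs i) h t).symm
  have hval (t : Fin M.size) : p ∈ M.toPODTMC.val t ↔ M.val t p := Iff.rfl
  simp only [hcast, hval]
  norm_cast

theorem mul_convexComb_lt_iff {K : Type*} [Field K] [LinearOrder K] [IsStrictOrderedRing K]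
    {c x y : K} (hc0 : 0 < c) (hc1 : c < 1) : c * (c * x + (1 - c) * y) < c * x ↔ y < x := by
  rw [mul_lt_mul_iff_right₀ hc0, ← sub_pos, ← sub_pos (a := x),
    show x - (c * x + (1 - c) * y) = (1 - c) * (x - y) by ring,
    mul_pos_iff_of_pos_left (sub_pos.2 hc1)]

namespace ThresholdChain

open Matrix

/-- The states of the chain of a threshold problem: an initial state, an absorbing one, the
coordinates together with the last matrix applied (`none` before the first one), and the two states
whose relative probability is compared with the threshold. -/
inductive Node (Λ D : Type)
  | start
  | sink
  | coord (l : Option Λ) (d : D)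
  | goal
  | miss
  deriving Fintype

variable {Λ D : Type}

namespace Node

/-- The initial distribution of the chain of a threshold problem. -/
def initial : Node Λ D → ℚ
  | start => 1
  | _ => 0

theorem initial_nonneg (s : Node Λ D) : 0 ≤ initial s := by
  unfold initial
  split <;> simp

theorem initial_of_ne_start {s : Node Λ D} (hs : s ≠ start) : initial s = 0 := by
  unfold initial
  split
  · contradiction
  · rfl

variable [Fintype Λ] [Fintype D]

theorem sum_eq {K : Type*} [AddCommMonoid K] (f : Node Λ D → K) :
    ∑ s, f s = f start + f sink + f goal + f miss + ∑ l, ∑ d, f (coord l d) := by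
  let e : Node Λ D ≃ Fin 4 ⊕ (Option Λ × D) :=
    { toFun
        | start => .inl 0
        | sink => .inl 1
        | goal => .inl 2
        | miss => .inl 3
        | coord l d => .inr (l, d)
      invFun
        | .inl 0 => start
        | .inl 1 => sink
        | .inl 2 => goal
        | .inl 3 => miss
        | .inr (l, d) => coord l d
      left_inv s := by cases s <;> rfl
      right_inv s := by
        rcases s with j | _
        · fin_cases j <;> rfl
        · rfl }
  rw [← e.symm.sum_comp, Fintype.sum_sum_type, Fin.sum_univ_four, Fintype.sum_prod_type]
  rfl

/-- The observation of the last matrix applied. -/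
noncomputable def letterObs (l : Option Λ) : ℕ :=
  Fintype.equivFin (Option Λ) l + 3

/-- The observation made at a state. It reveals the last matrix applied, but neither the coordinate
nor which of the two final states has been reached. -/
noncomputable def observe : Node Λ D → ℕ
  | start => 0
  | sink => 1
  | goal | miss => 2
  | coord l _ => letterObs l

/-- Whether a state is `goal`. -/
def isGoal : Node Λ D → Bool
  | goal => true
  | _ => false

theorem letterObs_injective : Function.Injective (letterObs (Λ := Λ)) := fun _ _ h =>
  (Fintype.equivFin _).injective (Fin.val_injective (Nat.add_right_cancel h))

section Sums

variable {K : Type*} [AddCommMonoid K]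

theorem sum_observe_start (f : Node Λ D → K) : ∑ s with observe s = 0, f s = f start := by
  rw [Finset.sum_filter, sum_eq]
  simp [observe, letterObs]

theorem sum_observe_final (f : Node Λ D → K) : ∑ s with observe s = 2, f s = f goal + f miss := by
  rw [Finset.sum_filter, sum_eq]
  simp [observe, letterObs]

theorem sum_observe_read (l : Option Λ) (f : Node Λ D → K) :
    ∑ s with observe s = letterObs l, f s = ∑ d, f (coord l d) := by
  have h (j : ℕ) (hj : j < 3) : j ≠ letterObs l := by
    unfold letterObs
    lia
  classical
  rw [Finset.sum_filter, sum_eq, Finset.sum_eq_single l]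
  · simp [observe, h]
  · intro l' _ hl'
    simp [observe, letterObs_injective.ne hl']
  · simp

end Sums

end Node

open Node

variable [Fintype Λ] [Fintype D] (T : Λ → Matrix D D ℕ) (u a b : D → ℕ) (c : ℚ)

/-- A normalizing constant for the transitions from the coordinates. -/
def rowBound : ℕ := ∑ d, (∑ l, ∑ d', T l d d' + a d + b d) + 1

/-- The transition probabilities of the chain of the threshold problem `T, u, a, b`, except for the
mass going to the absorbing state. The weights `c` and `1 - c` make the conditional probability of
`goal` exceed `c` exactly if `a` outweighs `b`. -/
def weight : Node Λ D → Node Λ D → ℚ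
  | .start, .coord none d => u d / ∑ d, u d
  | .coord _ d, .coord (some l) d' => T l d d' / rowBound T a b
  | .coord _ d, .goal => c * a d / rowBound T a b
  | .coord _ d, .miss => (1 - c) * b d / rowBound T a b
  | _, _ => 0

theorem le_rowBound (d : D) : ∑ l, ∑ d', T l d d' + a d + b d ≤ rowBound T a b :=
  (Finset.single_le_sum (f := fun d => ∑ l, ∑ d', T l d d' + a d + b d)
    (fun _ _ => Nat.zero_le _) (Finset.mem_univ d)).trans (Nat.le_succ _)

theorem sum_weight_start : ∑ t, weight T u a b c start t = (∑ d, u d) / ∑ d, u d := by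
  rw [Node.sum_eq]
  simp [weight, Finset.sum_div]

theorem sum_weight_read (l : Option Λ) (d : D) :
    ∑ t, weight T u a b c (coord l d) t =
      (∑ l, ∑ d', T l d d' + c * a d + (1 - c) * b d) / rowBound T a b := by
  rw [Node.sum_eq]
  simp only [weight, Fintype.sum_option, Finset.sum_const_zero, ← Finset.sum_div]
  push_cast
  ring

variable {c} in
theorem weight_nonneg (hc0 : 0 ≤ c) (hc1 : c ≤ 1) (s t : Node Λ D) :
    0 ≤ weight T u a b c s t := by
  have := sub_nonneg.2 hc1
  unfold weight
  split <;> positivity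

variable {c} in
theorem sum_weight_le (hc0 : 0 ≤ c) (hc1 : c ≤ 1) (s : Node Λ D) :
    ∑ t, weight T u a b c s t ≤ 1 := by
  rcases s with _ | _ | ⟨l, d⟩ | _ | _
  case start =>
    rw [sum_weight_start]
    exact div_self_le_one _
  case coord =>
    rw [sum_weight_read]
    refine div_le_one_of_le₀ ?_ (Nat.cast_nonneg _)
    calc (∑ l, ∑ d', T l d d' + c * a d + (1 - c) * b d : ℚ)
        ≤ ∑ l, ∑ d', T l d d' + 1 * a d + 1 * b d := by
          gcongr
          linarith
      _ ≤ rowBound T a b := by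
          rw [one_mul, one_mul]
          exact_mod_cast le_rowBound T a b d
  all_goals simp [weight]

/-- The transition probabilities of the chain of the threshold problem `T, u, a, b`. -/
def prob (s : Node Λ D) : Node Λ D → ℚ
  | sink => 1 - ∑ t, weight T u a b c s t
  | t => weight T u a b c s t

theorem sum_prob (s : Node Λ D) : ∑ t, prob T u a b c s t = 1 := by
  have hsink : weight T u a b c s sink = 0 := by cases s <;> rfl
  rw [Node.sum_eq]
  simp only [prob, Node.sum_eq (weight T u a b c s), hsink]
  ring

variable {c} in
theorem prob_nonneg (hc0 : 0 ≤ c) (hc1 : c ≤ 1) (s t : Node Λ D) : 0 ≤ prob T u a b c s t := by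
  unfold prob
  split
  · exact sub_nonneg.2 (sum_weight_le T u a b hc0 hc1 s)
  · exact weight_nonneg T u a b hc0 hc1 s _

/-- The joint weight of a history of observations, latest first, and of the state of the chain
after it. -/
noncomputable def forecast : List ℕ → Node Λ D → ℚ :=
  predict initial (prob T u a b c) observe

/-- The history of observations of the chain after it has applied the matrices of a word, both
latest first. -/
noncomputable def spell : List Λ → List ℕ
  | [] => [0]
  | _ :: w => letterObs w.head? :: spell w

variable {T u a b c}

theorem forecast_nonneg (hc0 : 0 ≤ c) (hc1 : c ≤ 1) (h : List ℕ) (t : Node Λ D) :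
    0 ≤ forecast T u a b c h t :=
  predict_nonneg initial_nonneg (prob_nonneg T u a b hc0 hc1) observe h t

theorem eq_nil_of_forecast_start_ne_zero {h : List ℕ} (hh : forecast T u a b c h start ≠ 0) :
    h = [] := by
  cases h with
  | nil => rfl
  | cons o h => exact absurd (by simp [forecast, predict, prob, weight]) hh

theorem exists_spell_of_forecast_read_ne_zero {h : List ℕ} {l : Option Λ} {d : D}
    (hh : forecast T u a b c h (coord l d) ≠ 0) : ∃ w, h = spell w ∧ l = w.head? := by
  induction h generalizing l d with
  | nil => exact absurd rfl hh
  | cons o h ih =>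
    obtain ⟨s, hs, hne⟩ := Finset.exists_ne_zero_of_sum_ne_zero hh
    obtain rfl : observe s = o := (Finset.mem_filter.1 hs).2
    have hprob := right_ne_zero_of_mul hne
    match s, l with
    | start, none =>
      rw [eq_nil_of_forecast_start_ne_zero (left_ne_zero_of_mul hne)]
      exact ⟨[], rfl, rfl⟩
    | coord l' d', some x =>
      obtain ⟨w, rfl, rfl⟩ := ih (left_ne_zero_of_mul hne)
      exact ⟨x :: w, rfl, rfl⟩
    | coord _ _, none | start, some _ | sink, _ | goal, _ | miss, _ => exact absurd rfl hprob

theorem exists_spell_of_forecast_goal_ne_zero {h : List ℕ}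
    (hh : forecast T u a b c h goal ≠ 0) : ∃ w, h = letterObs w.head? :: spell (Λ := Λ) w := by
  cases h with
  | nil => exact absurd rfl hh
  | cons o h =>
    obtain ⟨s, hs, hne⟩ := Finset.exists_ne_zero_of_sum_ne_zero hh
    obtain rfl : observe s = o := (Finset.mem_filter.1 hs).2
    match s with
    | coord l d =>
      obtain ⟨w, rfl, rfl⟩ := exists_spell_of_forecast_read_ne_zero (left_ne_zero_of_mul hne)
      exact ⟨w, rfl⟩
    | start | sink | goal | miss => exact absurd rfl (right_ne_zero_of_mul hne)

variable (T a b) in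
/-- The chain of the threshold problem `T, u, a, b`: all agents make the same observations, and all
atomic propositions hold exactly at `goal`. -/
noncomputable def chain (u : D → ℕ) {c : ℚ} (hc0 : 0 ≤ c) (hc1 : c ≤ 1) (n k : ℕ) :
    FinitePODTMC n k where
  size := Fintype.card (Node Λ D)
  init s := initial ((Fintype.equivFin (Node Λ D)).symm s)
  trans s t := prob T u a b c ((Fintype.equivFin _).symm s) ((Fintype.equivFin _).symm t)
  init_nonneg s := initial_nonneg _
  init_sum := by
    rw [Equiv.sum_comp, Node.sum_eq]
    simp [initial]
  trans_nonneg s t := prob_nonneg T u a b hc0 hc1 _ _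
  trans_sum s := by rw [Equiv.sum_comp, sum_prob]
  obs _ s := observe ((Fintype.equivFin (Node Λ D)).symm s)
  val s _ := isGoal ((Fintype.equivFin (Node Λ D)).symm s)

theorem sprModels_chain_iff_exists_forecast (hc0 : 0 ≤ c) (hc1 : c ≤ 1) {n k : ℕ} (i : Fin n)
    (p : Fin k) :
    (chain T a b u hc0 hc1 n k).toPODTMC.SprModels (.ex (.eventually (.probGt i (.atom p) c))) ↔
      ∃ o h, c * ∑ t with observe t = o, forecast T u a b c h t <
        ∑ t with observe t = o ∧ isGoal t, forecast T u a b c h t := by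
  let e : Fin (chain T a b u hc0 hc1 n k).size ≃ Node Λ D := (Fintype.equivFin (Node Λ D)).symm
  have hs₀ (s) (hs : s ≠ e.symm start) : (chain T a b u hc0 hc1 n k).init s = 0 :=
    initial_of_ne_start fun h => hs (e.eq_symm_apply.2 h)
  rw [(chain T a b u hc0 hc1 n k).sprModels_ex_eventually_probGt_iff i p hc0 hs₀]
  have hpredict (h t) : predict (chain T a b u hc0 hc1 n k).init
      (chain T a b u hc0 hc1 n k).trans ((chain T a b u hc0 hc1 n k).obs i) h t =
        forecast T u a b c h (e t) :=
    predict_comp_equiv e initial (prob T u a b c) observe h t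
  simp only [hpredict, Finset.sum_filter, ← e.sum_comp]
  rfl

variable [DecidableEq D]

theorem forecast_spell (w : List Λ) (d : D) :
    forecast T u a b c (spell w) (coord w.head? d) =
      (u ᵥ* (w.reverse.map T).prod) d / ((∑ d, u d : ℕ) * rowBound T a b ^ w.length) := by
  induction w generalizing d with
  | nil =>
    simp only [forecast, spell, predict, sum_observe_start]
    simp [initial, prob, weight]
  | cons x w ih =>
    calc forecast T u a b c (spell (x :: w)) (coord (some x) d)
        = ∑ d', forecast T u a b c (spell w) (coord w.head? d') * (T x d' d / rowBound T a b) :=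
          sum_observe_read _ _
      _ = (∑ d', (u ᵥ* (w.reverse.map T).prod) d' * T x d' d : ℕ) /
            ((∑ d, u d : ℕ) * rowBound T a b ^ (w.length + 1)) := by
          push_cast
          rw [Finset.sum_div]
          refine Finset.sum_congr rfl fun d' _ => ?_
          rw [ih, Nat.cast_sum, div_mul_div_comm, pow_succ, mul_assoc]
      _ = _ := by
          rw [List.reverse_cons, List.map_append, List.map_singleton, List.prod_append,
            List.prod_singleton, ← Matrix.vecMul_vecMul]
          rfl

theorem forecast_spell_final (w : List Λ) {t : Node Λ D} {r : ℚ} {f : D → ℕ}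
    (ht : ∀ l d, prob T u a b c (coord l d) t = r * f d / rowBound T a b) :
    forecast T u a b c (letterObs w.head? :: spell w) t =
      r * (u ᵥ* (w.reverse.map T).prod ⬝ᵥ f : ℕ) /
        ((∑ d, u d : ℕ) * rowBound T a b ^ (w.length + 1)) := by
  calc forecast T u a b c (letterObs w.head? :: spell w) t
      = ∑ d, forecast T u a b c (spell w) (coord w.head? d) * prob T u a b c (coord w.head? d) t :=
        sum_observe_read _ _
    _ = _ := by
        simp only [forecast_spell, ht, dotProduct, Nat.cast_sum, Nat.cast_mul, Finset.mul_sum,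
          Finset.sum_div]
        refine Finset.sum_congr rfl fun d _ => ?_
        rw [div_mul_div_comm, pow_succ, mul_assoc, mul_left_comm]

theorem lt_forecast_goal_iff (hu : u ≠ 0) (hc0 : 0 < c) (hc1 : c < 1) {w : List Λ} {h : List ℕ}
    (hh : h = letterObs w.head? :: spell w) :
    c * (forecast T u a b c h goal + forecast T u a b c h miss) < forecast T u a b c h goal ↔
      ExceedsThreshold T u a b w.reverse := by
  have hu' : (0 : ℚ) < (∑ d, u d : ℕ) := Nat.cast_pos.2 <| Nat.pos_of_ne_zero <|
    (Fintype.sum_eq_zero_iff_of_nonneg fun _ => Nat.zero_le _).not.2 hu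
  have hB : (0 : ℚ) < rowBound T a b := by exact_mod_cast Nat.succ_pos _
  rw [hh, forecast_spell_final w (t := goal) fun _ _ => rfl,
    forecast_spell_final w (t := miss) fun _ _ => rfl, ← add_div, ← mul_div_assoc,
    div_lt_div_iff_of_pos_right (mul_pos hu' (pow_pos hB _)),
    mul_convexComb_lt_iff hc0 hc1, Nat.cast_lt, ExceedsThreshold]

theorem sprModels_chain_iff (hu : u ≠ 0) (hc0 : 0 < c) (hc1 : c < 1) {n k : ℕ} (i : Fin n)
    (p : Fin k) :
    (chain T a b u hc0.le hc1.le n k).toPODTMC.SprModels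
      (.ex (.eventually (.probGt i (.atom p) c))) ↔ ∃ w, ExceedsThreshold T u a b w := by
  have hgoal (o h) : ∑ t with observe t = o ∧ isGoal t, forecast T u a b c h t =
      if o = 2 then forecast T u a b c h goal else 0 := by
    rw [Finset.sum_filter, Node.sum_eq]
    simp [observe, isGoal, eq_comm]
  simp only [sprModels_chain_iff_exists_forecast hc0.le hc1.le, hgoal]
  constructor
  · rintro ⟨o, h, hlt⟩
    have hpos := (mul_nonneg hc0.le
      (Finset.sum_nonneg fun t _ => forecast_nonneg hc0.le hc1.le h t)).trans_lt hlt
    obtain rfl : o = 2 := of_not_not fun ho => by simp [ho] at hpos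
    rw [if_pos rfl] at hpos hlt
    obtain ⟨w, rfl⟩ := exists_spell_of_forecast_goal_ne_zero hpos.ne'
    rw [sum_observe_final, lt_forecast_goal_iff hu hc0 hc1 rfl] at hlt
    exact ⟨_, hlt⟩
  · rintro ⟨w, hw⟩
    refine ⟨2, letterObs w.reverse.head? :: spell w.reverse, ?_⟩
    rw [if_pos rfl, sum_observe_final, lt_forecast_goal_iff hu hc0 hc1 rfl, List.reverse_reverse]
    exact hw

end ThresholdChain

theorem primrec_gcd : Primrec₂ Nat.gcd := by
  have hdvd : PrimrecRel fun d m : ℕ => d ∣ m :=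
    (Primrec.eq.comp (Primrec.nat_mod.comp Primrec.snd Primrec.fst) (Primrec.const 0)).of_eq
      fun _ => (Nat.dvd_iff_mod_eq_zero).symm
  have hcommon : PrimrecRel fun (x : ℕ × ℕ) (d : ℕ) => d ∣ x.1 ∧ d ∣ x.2 :=
    (hdvd.comp Primrec.snd (Primrec.fst.comp Primrec.fst)).and
      (hdvd.comp Primrec.snd (Primrec.snd.comp Primrec.fst))
  refine (Primrec.nat_findGreatest (Primrec.nat_add.comp Primrec.fst Primrec.snd) hcommon).of_eq
    fun x => Nat.findGreatest_eq_iff.2 ⟨?_, fun _ => ⟨Nat.gcd_dvd_left _ _, Nat.gcd_dvd_right _ _⟩,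
      fun d hd hle hdvd => hd.not_ge ?_⟩
  · rcases x.1.eq_zero_or_pos with h | h
    · rw [h, Nat.gcd_zero_left, zero_add]
    · exact (Nat.gcd_le_left _ h).trans (Nat.le_add_right _ _)
  · have hx : 0 < x.1 + x.2 := (Nat.zero_le _).trans_lt (hd.trans_le hle)
    have hgcd : 0 < x.1.gcd x.2 := Nat.gcd_pos_iff.2 (by lia)
    exact Nat.le_of_dvd hgcd (Nat.dvd_gcd hdvd.1 hdvd.2)

theorem primrec_sum {α ι : Type*} [Primcodable α] [Fintype ι] {f : α → ι → ℕ}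
    (hf : ∀ i, Primrec fun n => f n i) : Primrec fun n => ∑ i, f n i := by
  classical
  refine Finset.induction_on (motive := fun s => Primrec fun n => ∑ i ∈ s, f n i) Finset.univ
    ?_ fun i s hi ih => ?_
  · simpa using Primrec.const 0
  · simpa only [Finset.sum_insert hi] using Primrec.nat_add.comp (hf i) ih

theorem ratCode_div {a b : ℕ} (hb : b ≠ 0) :
    FinitePODTMC.ratCode (a / b) = (a / a.gcd b, b / a.gcd b) := by
  have hb' := Nat.pos_of_ne_zero hb
  have hcast : (a / b : ℚ) = ((a / a.gcd b : ℕ) : ℤ) / ((b / a.gcd b : ℕ) : ℤ) := by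
    rw [Int.cast_natCast, Int.cast_natCast,
      Nat.cast_div_div_div_cancel_right (Nat.gcd_dvd_right a b) (Nat.gcd_dvd_left a b)]
  have hpos : 0 < ((b / a.gcd b : ℕ) : ℤ) := Int.natCast_pos.2 (Nat.div_gcd_pos_of_pos_right a hb')
  have hcoprime : ((a / a.gcd b : ℕ) : ℤ).natAbs.Coprime ((b / a.gcd b : ℕ) : ℤ).natAbs :=
    Nat.coprime_div_gcd_div_gcd (Nat.gcd_pos_of_pos_right a hb')
  ext
  · rw [FinitePODTMC.ratCode, hcast, Rat.num_div_eq_of_coprime hpos hcoprime, Int.toNat_natCast]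
  · rw [FinitePODTMC.ratCode, hcast]
    exact_mod_cast Rat.den_div_eq_of_coprime hpos hcoprime

theorem primrec_ratCode_div {α : Type*} [Primcodable α] {f g : α → ℕ} (hf : Primrec f)
    (hg : Primrec g) (hg0 : ∀ n, g n ≠ 0) : Primrec fun n => FinitePODTMC.ratCode (f n / g n) := by
  have hgcd := primrec_gcd.comp hf hg
  exact ((Primrec.nat_div.comp hf hgcd).pair (Primrec.nat_div.comp hg hgcd)).of_eq fun n =>
    (ratCode_div (hg0 n)).symm

namespace ThresholdChain

open Node

variable {Λ D : Type} [Fintype Λ] [Fintype D]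

theorem prob_eq_of_ne_start (T : Λ → Matrix D D ℕ) (u u' a b : D → ℕ) (c : ℚ) {s : Node Λ D}
    (hs : s ≠ start) : prob T u a b c s = prob T u' a b c s := by
  have hweight : weight T u a b c s = weight T u' a b c s := by
    funext t
    match s, t with
    | coord _ _, coord none _ | coord _ _, coord (some _) _ => rfl
    | coord _ _, start | coord _ _, sink | coord _ _, goal | coord _ _, miss => rfl
    | sink, _ | goal, _ | miss, _ => rfl
  funext t
  simp only [prob, hweight]

theorem primrec_ratCode_prob (T : Λ → Matrix D D ℕ) {u : ℕ → D → ℕ} (a b : D → ℕ) (c : ℚ)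
    (hu : ∀ d, Primrec fun m => u m d) (hu0 : ∀ m, u m ≠ 0) (s t : Node Λ D) :
    Primrec fun m => FinitePODTMC.ratCode (prob T (u m) a b c s t) := by
  by_cases hs : s = start
  · subst hs
    have hsum (m) : ∑ d, u m d ≠ 0 :=
      (Fintype.sum_eq_zero_iff_of_nonneg fun _ => Nat.zero_le _).not.2 (hu0 m)
    match t with
    | coord none d =>
      simpa only [Nat.cast_sum, prob, weight] using primrec_ratCode_div (hu d) (primrec_sum hu) hsum
    | sink =>
      refine (Primrec.const (FinitePODTMC.ratCode 0)).of_eq fun m => ?_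
      rw [prob, sum_weight_start, div_self, sub_self]
      exact_mod_cast hsum m
    | start | goal | miss | coord (some _) _ => exact Primrec.const (FinitePODTMC.ratCode 0)
  · exact (Primrec.const (FinitePODTMC.ratCode (prob T (u 0) a b c s t))).of_eq fun m =>
      congrArg FinitePODTMC.ratCode (congrFun (prob_eq_of_ne_start T (u 0) (u m) a b c hs) t)

theorem primrec_encode_chain (T : Λ → Matrix D D ℕ) {u : ℕ → D → ℕ} (a b : D → ℕ) {c : ℚ}
    (hu : ∀ d, Primrec fun m => u m d) (hu0 : ∀ m, u m ≠ 0) (hc0 : 0 ≤ c) (hc1 : c ≤ 1)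
    (n k : ℕ) : Primrec fun m => (chain T a b (u m) hc0 hc1 n k).encode := by
  let e := (Fintype.equivFin (Node Λ D)).symm
  have htrans : Primrec fun m => List.ofFn fun s => List.ofFn fun t =>
      FinitePODTMC.ratCode (prob T (u m) a b c (e s) (e t)) :=
    Primrec.list_ofFn fun s => Primrec.list_ofFn fun t =>
      primrec_ratCode_prob T a b c hu hu0 (e s) (e t)
  let C := (chain T a b (u 0) hc0 hc1 n k).encode
  exact ((Primrec.const C.1).pair ((Primrec.const C.2.1).pair (htrans.pair
    ((Primrec.const C.2.2.2.1).pair (Primrec.const C.2.2.2.2))))).of_eq fun m => rfl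

end ThresholdChain

end PerfectRecall

theorem theorem2 (n k : ℕ) (i : Fin n) (p : Fin k) (c : ℚ) (hc0 : 0 < c) (hc1 : c < 1) :
    ¬ PerfectRecall.DecidableProperty (fun M : PerfectRecall.FinitePODTMC n k =>
        M.toPODTMC.SprModels
          (PerfectRecall.Formula.ex (PerfectRecall.Formula.eventually
            (PerfectRecall.Formula.probGt i (PerfectRecall.Formula.atom p) c)))) := by
  rintro ⟨Q, hQ, hQM⟩
  have heval : Partrec fun m : ℕ => (Denumerable.ofNat Nat.Partrec.Code m).eval 0 :=
    Nat.Partrec.Code.eval_part.comp (Computable.ofNat _) (Computable.const 0)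
  obtain ⟨Λ, D, _, _, _, T, u, a, b, hu, hu0, hdom⟩ :=
    PerfectRecall.exists_exceedsThreshold_iff_dom heval
  have := Fintype.ofFinite Λ
  have hencode :=
    PerfectRecall.ThresholdChain.primrec_encode_chain T a b hu hu0 hc0.le hc1.le n k
  refine ComputablePred.halting_problem 0 (hQ.computable_of_manyOneReducible
    ⟨_, hencode.to_comp.comp Computable.encode, fun e => ?_⟩)
  simp only [hQM, PerfectRecall.ThresholdChain.sprModels_chain_iff (hu0 _) hc0 hc1, hdom,
    Denumerable.ofNat_encode]
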